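/- Notation. For probability measures $\mu,\nu$ on $\mathbb R$ let $\mathrm{Marg}(\mu,\nu)$ be the set of probability measures on $\mathbb R\times\mathbb R$ with first marginal $\mu$ and second marginal $\nu$, equipped with the weak convergence of probability measures. For $p>0$ let $T_p(\pi)=\iint|y-x|^p\,d\pi(x,y)\in[0,\infty]$, and let $\mathrm{Marg}^*_p(\mu,\nu)$ be the set of minimizers of $T_p$ on $\mathrm{Marg}(\mu,\nu)$ (the $L^p$-optimal plans). Excursion coupling. First let $\mu\perp\nu$ and put $F(x)=\mu(]-\infty,x])-\nu(]-\infty,x])$. Let $\mathrm{Graph}^*$ be the set of $(x,h)\in\mathbb R^2$ such that $h$ lies in the closed interval with end points $F(x^-)$ and $F(x)$. A point $(x,h)\in\mathrm{Graph}^*$ is called increasing (respectively decreasing) if $x$ has a neighborhood $U$ such that $(h'-h)(x'-x)>0$ (respectively $<0$) for all $(x',h')\in\mathrm{Graph}^*$ with $x'\in U\setminus\{x\}$. Let $i^{\pm}(h)$ be the number of increasing points plus the number of decreasing points with second coordinate $h$, and let $\theta$ be the measure with density $i^\pm$ with respect to the Lebesgue measure. Let $H$ have law $\theta/2$, and let $x_1<\dots<x_N$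 be the points $x$ with $(x,H)\in\mathrm{Graph}^*$ (almost surely $N$ is finite, even and equal to $i^{\pm}(H)$). Given $H$, let $(X,Y)$ be uniform on $\{(x_1,x_2),(x_3,x_4),\dots,(x_{N-1},x_N)\}$ if $H>0$, and uniform on $\{(x_2,x_1),(x_4,x_3),\dots,(x_N,x_{N-1})\}$ if $H<0$. The excursion coupling of $\mu$ and $\nu$ is the law of $(X,Y)$. For general $\mu,\nu$ put $\eta=\mu\wedge\nu$, $\mu=\eta+\mu_0$, $\nu=\eta+\nu_0$ and $m=\mu_0(\mathbb R)=\nu_0(\mathbb R)$. The excursion coupling of $\mu$ and $\nu$ is then $(\mathrm{id}\times\mathrm{id})_\#\eta+m\,\pi_0$, where $\pi_0$ is the excursion coupling of the mutually singular probability measures $m^{-1}\mu_0$ and $m^{-1}\nu_0$ (the second term is absent if $m=0$). Statement. Let $\mu$ and $\nu$ be Borel probability measures on $\mathbb R$ with finite first moment. The excursion coupling $\pi$ of $\mu$ and $\nu$ belongs to $\mathrm{Marg}(\mu,\nu)$ and satisfies the two following statements. (1') For every sequence $(\pi_n,p_n)_{n\in\mathbb N}$ with $0<p_n<1$, $p_n\to1$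 and $\pi_n\in\mathrm{Marg}^*_{p_n}(\mu,\nu)$ for every $n$, it holds $\pi_n\to\pi$ weakly. (2') For every $q'$ with $0<q'<1$, $\pi$ belongs to $\mathrm{Marg}^*_1(\mu,\nu)$ and minimizes $\gamma\mapsto\iint|y-x|^{q'}\,d\gamma(x,y)$ over $\mathrm{Marg}^*_1(\mu,\nu)$. -/

import Mathlib

open MeasureTheory Filter Topology
open scoped ENNReal

/-- `Marg(μ, ν)`: the transport plans, i.e. the probability measures on `ℝ × ℝ` with first
marginal `μ` and second marginal `ν`. -/
def Marg (μ ν : Measure ℝ) : Set (ProbabilityMeasure (ℝ × ℝ)) :=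
  {π | (π : Measure (ℝ × ℝ)).map Prod.fst = μ ∧ (π : Measure (ℝ × ℝ)).map Prod.snd = ν}

/-- The cost `T_p(π) = ∬ |y - x| ^ p dπ(x, y)`, with values in `[0, ∞]`. -/
noncomputable def transportCost (p : ℝ) (π : ProbabilityMeasure (ℝ × ℝ)) : ℝ≥0∞ :=
  ∫⁻ z, ENNReal.ofReal (|z.2 - z.1| ^ p) ∂(π : Measure (ℝ × ℝ))

/-- `Marg*_p(μ, ν)`: the minimizers of `T_p` among the transport plans. -/
def OptMarg (p : ℝ) (μ ν : Measure ℝ) : Set (ProbabilityMeasure (ℝ × ℝ)) :=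
  {π | π ∈ Marg μ ν ∧ ∀ γ ∈ Marg μ ν, transportCost p π ≤ transportCost p γ}

namespace Excursion

/-- `F_σ = F_μ - F_ν`, the cumulative distribution function of `σ = μ - ν`. -/
noncomputable def cdfDiff (μ ν : Measure ℝ) (x : ℝ) : ℝ :=
  μ.real (Set.Iic x) - ν.real (Set.Iic x)

/-- The graph of `F`, completed at every jump by the vertical segment between the left limit
`F (x⁻)` and the value `F x`. -/
def genGraph (F : ℝ → ℝ) : Set (ℝ × ℝ) :=
  {z | z.2 ∈ Set.uIcc (Function.leftLim F z.1) (F z.1)}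

/-- The increasing points of the completed graph. -/
def incPoints (F : ℝ → ℝ) : Set (ℝ × ℝ) :=
  {z | z ∈ genGraph F ∧ ∃ U ∈ 𝓝 z.1, ∀ w ∈ genGraph F, w.1 ∈ U \ {z.1} →
    0 < (w.2 - z.2) * (w.1 - z.1)}

/-- The decreasing points of the completed graph. -/
def decPoints (F : ℝ → ℝ) : Set (ℝ × ℝ) :=
  {z | z ∈ genGraph F ∧ ∃ U ∈ 𝓝 z.1, ∀ w ∈ genGraph F, w.1 ∈ U \ {z.1} →
    (w.2 - z.2) * (w.1 - z.1) < 0}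

/-- `i^±(h)`: the number of increasing points plus the number of decreasing points at
height `h`. -/
noncomputable def indicatrix (F : ℝ → ℝ) (h : ℝ) : ℝ≥0∞ :=
  (({x : ℝ | (x, h) ∈ incPoints F}.encard + {x : ℝ | (x, h) ∈ decPoints F}.encard : ℕ∞) : ℝ≥0∞)

/-- The law `θ / 2` of the random level `H`, where `θ` has density `i^±` with respect to the
Lebesgue measure. -/
noncomputable def levelLaw (F : ℝ → ℝ) : Measure ℝ :=
  (2 : ℝ≥0∞)⁻¹ • volume.withDensity (indicatrix F)

/-- The transport routes at level `h`. If `x₁ < ⋯ < x_N` are the generalized solutions of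
`F = h`, they are `(x₁, x₂), (x₃, x₄), …` when `h > 0`, and `(x₂, x₁), (x₄, x₃), …` when `h < 0`.
(The enumeration below starts at the index `0`.) -/
def routes (F : ℝ → ℝ) (h : ℝ) : Set (ℝ × ℝ) :=
  {z | ∃ (N : ℕ) (x : Fin N → ℝ) (i j : Fin N),
    StrictMono x ∧ Set.range x = {t : ℝ | (t, h) ∈ genGraph F} ∧
    Even (i : ℕ) ∧ (j : ℕ) = i + 1 ∧
    ((0 < h ∧ z = (x i, x j)) ∨ (h < 0 ∧ z = (x j, x i)))}

/-- The excursion coupling of two mutually singular probability measures: the law of `(X, Y)`,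
where `H` has law `θ / 2` and, given `H`, the pair `(X, Y)` is uniform on the routes at
level `H`. -/
noncomputable def singularCoupling (μ ν : Measure ℝ) : Measure (ℝ × ℝ) :=
  (levelLaw (cdfDiff μ ν)).bind fun h =>
    ProbabilityTheory.uniformOn (routes (cdfDiff μ ν) h)

end Excursion

/-- The excursion coupling of two probability measures `μ` and `ν`. With `η = μ ∧ ν`,
`μ = η + μ₀` and `ν = η + ν₀`, the common part `η` stays in place, and with the remaining
probability `m = μ₀(ℝ) = ν₀(ℝ)` the coupling is that of the mutually singular probability
measures `m⁻¹ μ₀` and `m⁻¹ ν₀`. -/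
noncomputable def excursionCoupling (μ ν : Measure ℝ) : Measure (ℝ × ℝ) :=
  (μ ⊓ ν).map (fun x => (x, x)) +
    (μ - (μ ⊓ ν)) Set.univ •
      Excursion.singularCoupling (((μ - (μ ⊓ ν)) Set.univ)⁻¹ • (μ - (μ ⊓ ν)))
        (((ν - (μ ⊓ ν)) Set.univ)⁻¹ • (ν - (μ ⊓ ν)))

/-! Optimality for a strictly concave function of the distance forbids local improvements by
exchanging the targets of two routes. Two routes in the same direction cannot cross (they are nested
or disjoint), and no route starts where another one ends, so that the common mass `μ ⊓ ν` stays in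
place. Optimality for the distance itself forbids overlapping routes in opposite directions. These
three properties characterize the excursion coupling.

For the characterization (`eq_excursionCoupling`), let `F = cdfDiff μ ν`. Without opposite overlaps,
the mass of rightward routes over a point `t` is the positive part of `F t` (`measure_cover_self`).
Without crossings and without common atoms off the diagonal, the mass of the routes over a whole
interval `[a, b]` is the infimum of these pointwise masses (`measure_cover_eq_iInf`). Such masses,
together with their mirror images, determine a finite measure off the diagonal (`ext_of_cover`). The
excursion coupling has the same masses: almost every level `h > 0` has exactly one route over `[a,
b]` if `h` lies below the infimum of `F` there and none if it lies above, so integrating over `h`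
gives the positive part of that infimum (`singularCoupling_cover`). Here a Banach indicatrix
argument shows that almost every level has finitely many solutions, and outside countably many
levels all of them are genuine crossings, whose directions alternate.

For the two statements, plans form a compact set and the crossing conditions are open, so
non-crossing survives weak limits; so does the immobility of the common mass, by upper
semicontinuity on closed subsets of the diagonal. Hence a limit of strictly concave optimizers which
is itself optimal for the distance is the excursion coupling (`eq_excursionCoupling_of_tendsto`).
This applies to the costs `r ^ p` with `p → 1`, which gives (1') after extraction of subsequences,
and to `r + ε * r ^ q` with `ε → 0`, whose minimizers converge along a subsequence to a minimizer of
`T_q` among the distance-optimal plans, which gives (2'). -/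

/-! ### Exchanging targets of a plan -/

namespace Excursion

/-- The plan in which the pairs of routes in `W` exchange their targets. -/
noncomputable def exchange (γ : Measure (ℝ × ℝ)) (W : Set ((ℝ × ℝ) × ℝ × ℝ)) :
    Measure (ℝ × ℝ) :=
  open scoped Classical in
  (γ.prod γ).map (W.piecewise (fun p => (p.1.1, p.2.2)) Prod.fst)

section exchange

variable {γ : Measure (ℝ × ℝ)} {W : Set ((ℝ × ℝ) × ℝ × ℝ)}

lemma measurable_exchange_map (hW : MeasurableSet W) [∀ p, Decidable (p ∈ W)] :
    Measurable (W.piecewise (fun p : (ℝ × ℝ) × ℝ × ℝ => (p.1.1, p.2.2)) Prod.fst) :=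
  Measurable.piecewise hW (by fun_prop) (by fun_prop)

lemma lintegral_exchange (hW : MeasurableSet W) {f : ℝ × ℝ → ℝ≥0∞} (hf : Measurable f) :
    ∫⁻ z, f z ∂(exchange γ W) =
      ∫⁻ p in W, f (p.1.1, p.2.2) ∂(γ.prod γ) + ∫⁻ p in Wᶜ, f p.1 ∂(γ.prod γ) := by
  classical
  rw [exchange, lintegral_map hf (measurable_exchange_map hW), ← lintegral_add_compl _ hW]
  congr 1
  · refine setLIntegral_congr_fun hW fun p hp => ?_
    simp [Set.piecewise_eq_of_mem _ _ _ hp]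
  · refine setLIntegral_congr_fun hW.compl fun p hp => ?_
    simp [Set.piecewise_eq_of_notMem _ _ _ hp]

variable [IsProbabilityMeasure γ]

lemma lintegral_split (hW : MeasurableSet W) {f : ℝ × ℝ → ℝ≥0∞} (hf : Measurable f) :
    ∫⁻ z, f z ∂γ = ∫⁻ p in W, f p.1 ∂(γ.prod γ) + ∫⁻ p in Wᶜ, f p.1 ∂(γ.prod γ) := by
  rw [lintegral_add_compl _ hW, ← lintegral_map (μ := γ.prod γ) hf measurable_fst,
    Measure.map_fst_prod]
  simp

lemma setLIntegral_swap (hW : MeasurableSet W) (hs : Prod.swap ⁻¹' W = W)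
    {f : (ℝ × ℝ) × ℝ × ℝ → ℝ≥0∞} (hf : Measurable f) :
    ∫⁻ p in W, f p.swap ∂(γ.prod γ) = ∫⁻ p in W, f p ∂(γ.prod γ) := by
  have := (Measure.measurePreserving_swap (μ := γ) (ν := γ)).setLIntegral_comp_preimage hW hf
  rwa [hs] at this

instance isProbabilityMeasure_exchange [Fact (MeasurableSet W)] :
    IsProbabilityMeasure (exchange γ W) := by
  classical
  exact Measure.isProbabilityMeasure_map (measurable_exchange_map Fact.out).aemeasurable

lemma map_fst_exchange (hW : MeasurableSet W) : (exchange γ W).map Prod.fst = γ.map Prod.fst := by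
  classical
  rw [exchange, Measure.map_map measurable_fst (measurable_exchange_map hW)]
  have : Prod.fst ∘ (W.piecewise (fun p : (ℝ × ℝ) × ℝ × ℝ => (p.1.1, p.2.2)) Prod.fst)
      = Prod.fst ∘ Prod.fst := by
    ext p
    by_cases hp : p ∈ W <;> simp [hp]
  rw [this, ← Measure.map_map measurable_fst measurable_fst, Measure.map_fst_prod]
  simp

/-- The symmetry of `W` matters here: on `W` the targets of the first and of the second route have
the same distribution. -/
lemma map_snd_exchange (hW : MeasurableSet W) (hs : Prod.swap ⁻¹' W = W) :
    (exchange γ W).map Prod.snd = γ.map Prod.snd := by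
  ext s hm
  have hf : Measurable (fun z : ℝ × ℝ => s.indicator (1 : ℝ → ℝ≥0∞) z.2) :=
    (measurable_one.indicator hm).comp measurable_snd
  have key : ∀ ρ : Measure (ℝ × ℝ), ρ.map Prod.snd s
      = ∫⁻ z, s.indicator (1 : ℝ → ℝ≥0∞) z.2 ∂ρ := by
    intro ρ
    rw [← lintegral_indicator_one hm, lintegral_map (measurable_one.indicator hm) measurable_snd]
  rw [key, key, lintegral_exchange hW hf, lintegral_split hW hf]
  congr 1
  exact setLIntegral_swap (γ := γ) hW hs
    (f := fun p => s.indicator (1 : ℝ → ℝ≥0∞) p.1.2) (hf.comp measurable_fst)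

/-- For a plan that minimizes the cost `c`, exchanging the targets of two of its routes does not
decrease their total cost. -/
lemma ae_exchange_le {μ ν : Measure ℝ} {π : ProbabilityMeasure (ℝ × ℝ)} (hπ : π ∈ Marg μ ν)
    {c : ℝ × ℝ → ℝ≥0∞} (hc : Measurable c)
    (hfin : ∫⁻ z, c z ∂(π : Measure (ℝ × ℝ)) ≠ ∞)
    (hmin : ∀ γ ∈ Marg μ ν,
      ∫⁻ z, c z ∂(π : Measure (ℝ × ℝ)) ≤ ∫⁻ z, c z ∂(γ : Measure (ℝ × ℝ))) :
    ∀ᵐ p ∂((π : Measure (ℝ × ℝ)).prod (π : Measure (ℝ × ℝ))),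
      c p.1 + c p.2 ≤ c (p.1.1, p.2.2) + c (p.2.1, p.1.2) := by
  set γ : Measure (ℝ × ℝ) := (π : Measure (ℝ × ℝ)) with hγ
  have hm1 : Measurable fun p : (ℝ × ℝ) × ℝ × ℝ => c (p.1.1, p.2.2) := hc.comp (by fun_prop)
  have hm2 : Measurable fun p : (ℝ × ℝ) × ℝ × ℝ => c (p.2.1, p.1.2) := hc.comp (by fun_prop)
  have hm3 : Measurable fun p : (ℝ × ℝ) × ℝ × ℝ => c p.1 := hc.comp (by fun_prop)
  have hm4 : Measurable fun p : (ℝ × ℝ) × ℝ × ℝ => c p.2 := hc.comp (by fun_prop)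
  set W : Set ((ℝ × ℝ) × ℝ × ℝ) := {p | c (p.1.1, p.2.2) + c (p.2.1, p.1.2) < c p.1 + c p.2}
    with hWdef
  have hWm : ∀ p ∈ W, c (p.1.1, p.2.2) + c (p.2.1, p.1.2) < c p.1 + c p.2 := fun p hp => hp
  have hW : MeasurableSet W := measurableSet_lt (hm1.add hm2) (hm3.add hm4)
  have hs : Prod.swap ⁻¹' W = W := by
    ext p
    simp only [hWdef, Set.mem_preimage, Set.mem_ofPred_eq, Prod.fst_swap, Prod.snd_swap]
    rw [add_comm (c p.2), add_comm (c (p.2.1, p.1.2))]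
  have : Fact (MeasurableSet W) := ⟨hW⟩
  have hle := hmin ⟨exchange γ W, isProbabilityMeasure_exchange⟩
    ⟨(map_fst_exchange hW).trans hπ.1, (map_snd_exchange hW hs).trans hπ.2⟩
  simp only [ProbabilityMeasure.coe_mk] at hle
  rw [lintegral_exchange hW hc, lintegral_split hW hc] at hle
  have hfin' := hfin
  rw [lintegral_split hW hc] at hfin'
  have hfin1 := (ENNReal.add_ne_top.1 hfin').1
  -- Outside `W` both plans pay the same finite amount, which cancels.
  have hle1 := (ENNReal.add_le_add_iff_right (ENNReal.add_ne_top.1 hfin').2).1 hle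
  have e1 : ∫⁻ p in W, c p.2 ∂(γ.prod γ) = ∫⁻ p in W, c p.1 ∂(γ.prod γ) :=
    setLIntegral_swap hW hs hm3
  have e2 : ∫⁻ p in W, c (p.2.1, p.1.2) ∂(γ.prod γ) = ∫⁻ p in W, c (p.1.1, p.2.2) ∂(γ.prod γ) :=
    setLIntegral_swap hW hs hm1
  -- Swapping the two routes doubles the inequality on `W`. The integrands there satisfy the
  -- opposite strict inequality pointwise, which forces `W` to be null.
  have h2 : ∫⁻ p in W, (c p.1 + c p.2) ∂(γ.prod γ)
      ≤ ∫⁻ p in W, (c (p.1.1, p.2.2) + c (p.2.1, p.1.2)) ∂(γ.prod γ) := by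
    rw [lintegral_add_left hm3, lintegral_add_left hm1, e1, e2]
    exact add_le_add hle1 hle1
  have h3 : ∫⁻ p in W, (c p.1 + c p.2) ∂(γ.prod γ) ≠ ∞ := by
    rw [lintegral_add_left hm3, e1]
    exact ENNReal.add_ne_top.2 ⟨hfin1, hfin1⟩
  have h4 : (γ.prod γ) W = 0 := by
    by_contra hne
    have := setLIntegral_strict_mono hW hne (hm3.add hm4)
      (f := fun p => c (p.1.1, p.2.2) + c (p.2.1, p.1.2)) (ne_top_of_le_ne_top h3
        (setLIntegral_mono (hm3.add hm4) fun p hp => (hWm p hp).le)) (Eventually.of_forall hWm)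
    exact absurd h2 (not_le.2 this)
  filter_upwards [measure_eq_zero_iff_ae_notMem.1 h4] with p hp
  exact not_lt.1 fun h => hp h

/-- An open condition on pairs of routes that fails almost surely fails on the support. -/
lemma notMem_of_mem_support {O : Set ((ℝ × ℝ) × ℝ × ℝ)} (hO : IsOpen O)
    (h0 : (γ.prod γ) O = 0) {z w : ℝ × ℝ} (hz : z ∈ γ.support) (hw : w ∈ γ.support) :
    (z, w) ∉ O := by
  intro hmem
  obtain ⟨U, V, hU, hV, hzU, hwV, hUV⟩ := isOpen_prod_iff.1 hO z w hmem
  have h1 := (Measure.mem_support_iff_forall z).1 hz U (hU.mem_nhds hzU)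
  have h2 := (Measure.mem_support_iff_forall w).1 hw V (hV.mem_nhds hwV)
  have h3 : (γ.prod γ) (U ×ˢ V) = 0 := measure_mono_null hUV h0
  rw [Measure.prod_prod, mul_eq_zero] at h3
  rcases h3 with h | h
  · exact h1.ne' h
  · exact h2.ne' h

end exchange

/-! ### Strictly concave costs of the distance -/

/-- Profiles of the costs `g |y - x|` that are strictly concave functions of the distance. -/
structure ConcaveProfile (g : ℝ → ℝ) : Prop where
  continuous_abs : Continuous fun r => g |r|
  mono : MonotoneOn g (Set.Ici 0)
  concave : StrictConcaveOn ℝ (Set.Ici 0) g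
  zero : g 0 = 0

/-- The cost `∬ g |y - x| dπ(x, y)`. -/
noncomputable def profileCost (g : ℝ → ℝ) (π : ProbabilityMeasure (ℝ × ℝ)) : ℝ≥0∞ :=
  ∫⁻ z, ENNReal.ofReal (g |z.2 - z.1|) ∂(π : Measure (ℝ × ℝ))

/-- The pairs of routes whose total cost decreases when the targets are exchanged. -/
def improvable (g : ℝ → ℝ) : Set ((ℝ × ℝ) × ℝ × ℝ) :=
  {p | g |p.2.2 - p.1.1| + g |p.1.2 - p.2.1| < g |p.1.2 - p.1.1| + g |p.2.2 - p.2.1|}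

section cost

variable {g : ℝ → ℝ} {μ ν : Measure ℝ}

lemma isOpen_improvable (hg : Continuous fun r => g |r|) : IsOpen (improvable g) := by
  have h : ∀ {f : (ℝ × ℝ) × ℝ × ℝ → ℝ}, Continuous f → Continuous fun p => g |f p| :=
    fun hf => hg.comp hf
  exact isOpen_lt ((h (by fun_prop)).add (h (by fun_prop)))
    ((h (by fun_prop)).add (h (by fun_prop)))

lemma prod_improvable_eq_zero (hg : Continuous fun r => g |r|) (hg0 : ∀ r, 0 ≤ g |r|)
    {π : ProbabilityMeasure (ℝ × ℝ)} (hπ : π ∈ Marg μ ν) (hfin : profileCost g π ≠ ∞)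
    (hmin : ∀ γ ∈ Marg μ ν, profileCost g π ≤ profileCost g γ) :
    ((π : Measure (ℝ × ℝ)).prod (π : Measure (ℝ × ℝ))) (improvable g) = 0 := by
  have hc : Continuous fun z : ℝ × ℝ => g |z.2 - z.1| :=
    hg.comp (continuous_snd.sub continuous_fst)
  have := ae_exchange_le hπ (c := fun z => ENNReal.ofReal (g |z.2 - z.1|))
    (ENNReal.continuous_ofReal.comp hc).measurable hfin hmin
  rw [measure_eq_zero_iff_ae_notMem]
  filter_upwards [this] with p hp hlt
  rw [← ENNReal.ofReal_add (hg0 _) (hg0 _), ← ENNReal.ofReal_add (hg0 _) (hg0 _),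
    ENNReal.ofReal_le_ofReal_iff (add_nonneg (hg0 _) (hg0 _))] at hp
  exact absurd hlt (not_lt.2 hp)

end cost

namespace ConcaveProfile

variable {g : ℝ → ℝ} (hg : ConcaveProfile g)
include hg

lemma nonneg {r : ℝ} (hr : 0 ≤ r) : 0 ≤ g r :=
  hg.zero ▸ hg.mono Set.self_mem_Ici hr hr

lemma map_lt_of_between {u v s : ℝ} (hu : 0 ≤ u) (hus : u < s) (hsv : s < v) :
    (v - s) / (v - u) * g u + (s - u) / (v - u) * g v < g s := by
  have hd : 0 < v - u := by linarith
  have := hg.concave.2 (Set.mem_Ici.2 hu) (Set.mem_Ici.2 (by linarith : 0 ≤ v)) (by linarith)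
    (div_pos (by linarith : 0 < v - s) hd) (div_pos (by linarith : 0 < s - u) hd)
    (by field_simp; ring)
  simp only [smul_eq_mul] at this
  have hd' : v - u ≠ 0 := hd.ne'
  rwa [show (v - s) / (v - u) * u + (s - u) / (v - u) * v = s by field_simp; ring] at this

/-- As `s + t = u + v`, the barycentric weights of `s` and of `t` with respect to `u` and `v` add up
to one at each end point. The two concavity inequalities then sum to the claim. -/
lemma add_lt_add_of_between {u v s t : ℝ} (hu : 0 ≤ u) (hus : u < s) (hut : u < t)
    (h : s + t = u + v) : g u + g v < g s + g t := by
  have h1 := hg.map_lt_of_between hu hus (by linarith : s < v)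
  have h2 := hg.map_lt_of_between hu hut (by linarith : t < v)
  have hd : v - u ≠ 0 := by linarith
  have e : (v - s) / (v - u) * g u + (s - u) / (v - u) * g v
      + ((v - t) / (v - u) * g u + (t - u) / (v - u) * g v) = g u + g v := by
    obtain rfl : v = s + t - u := by linarith
    field_simp
    ring
  linarith

lemma map_add_lt {a b : ℝ} (ha : 0 < a) (hb : 0 < b) : g (a + b) < g a + g b := by
  have := hg.add_lt_add_of_between le_rfl ha hb (v := a + b) (by ring)
  rwa [hg.zero, zero_add] at this

/-- Routes that cross to the right can be improved. -/
lemma cross_right_subset :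
    {p : (ℝ × ℝ) × ℝ × ℝ | p.1.1 < p.2.1 ∧ p.2.1 < p.1.2 ∧ p.1.2 < p.2.2} ⊆ improvable g := by
  rintro ⟨⟨x, y⟩, x', y'⟩ ⟨h1, h2, h3⟩
  simp only at h1 h2 h3
  change g |y' - x| + g |y - x'| < g |y - x| + g |y' - x'|
  rw [abs_of_pos (by linarith), abs_of_pos (by linarith), abs_of_pos (by linarith),
    abs_of_pos (by linarith), add_comm]
  exact hg.add_lt_add_of_between (by linarith) (by linarith) (by linarith) (by ring)

/-- Routes that cross to the left can be improved. -/
lemma cross_left_subset :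
    {p : (ℝ × ℝ) × ℝ × ℝ | p.1.2 < p.2.2 ∧ p.2.2 < p.1.1 ∧ p.1.1 < p.2.1} ⊆ improvable g := by
  rintro ⟨⟨x, y⟩, x', y'⟩ ⟨h1, h2, h3⟩
  simp only at h1 h2 h3
  change g |y' - x| + g |y - x'| < g |y - x| + g |y' - x'|
  rw [abs_of_neg (by linarith), abs_of_neg (by linarith), abs_of_neg (by linarith),
    abs_of_neg (by linarith)]
  exact hg.add_lt_add_of_between (by linarith) (by linarith) (by linarith) (by ring)

/-- A pair of routes, one of which ends where the other one starts, can be improved. -/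
lemma mem_improvable_of_chain {x t y : ℝ} (hx : x ≠ t) (hy : t ≠ y) :
    ((x, t), t, y) ∈ improvable g := by
  change g |y - x| + g |t - t| < g |t - x| + g |y - t|
  have h1 : 0 < |t - x| := abs_pos.2 (sub_ne_zero.2 hx.symm)
  have h2 : 0 < |y - t| := abs_pos.2 (sub_ne_zero.2 hy.symm)
  have h3 := hg.mono (Set.mem_Ici.2 (abs_nonneg (y - x)))
    (Set.mem_Ici.2 (by positivity : 0 ≤ |t - x| + |y - t|))
    (by rw [show y - x = (t - x) + (y - t) by ring]; exact abs_add_le _ _)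
  have h4 := hg.map_add_lt h1 h2
  rw [sub_self, abs_zero, hg.zero]
  linarith

end ConcaveProfile

/-! ### The common mass -/

lemma measurableSet_of_isSigmaCompact {s : Set ℝ} (hs : IsSigmaCompact s) : MeasurableSet s := by
  obtain ⟨K, hK, rfl⟩ := hs
  exact MeasurableSet.iUnion fun n => (hK n).measurableSet

/-- An open set is a countable union of closed sets, so the image is σ-compact, hence Borel. -/
lemma measurableSet_image_closed_inter_open {f : ℝ × ℝ → ℝ} (hf : Continuous f)
    {C U : Set (ℝ × ℝ)} (hC : IsClosed C) (hU : IsOpen U) : MeasurableSet (f '' (C ∩ U)) := by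
  obtain ⟨K, hK, -, rfl, -⟩ := hU.exists_iUnion_isClosed
  refine measurableSet_of_isSigmaCompact (IsSigmaCompact.image hf ?_)
  rw [Set.inter_iUnion]
  exact isSigmaCompact_iUnion _ fun n =>
    isSigmaCompact_univ.of_isClosed_subset (hC.inter (hK n)) (Set.subset_univ _)

section common

variable {μ ν : Measure ℝ} {γ : Measure (ℝ × ℝ)}

lemma map_fst_restrict_diagonal :
    (γ.restrict (Set.diagonal ℝ)).map Prod.fst = (γ.restrict (Set.diagonal ℝ)).map Prod.snd := by
  refine Measure.map_congr ?_
  filter_upwards [ae_restrict_mem isClosed_diagonal.measurableSet] with z hz using hz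

lemma map_fst_split (h1 : γ.map Prod.fst = μ) :
    μ = (γ.restrict (Set.diagonal ℝ)).map Prod.fst
      + (γ.restrict (Set.diagonal ℝ)ᶜ).map Prod.fst := by
  rw [← Measure.map_add _ _ measurable_fst,
    Measure.restrict_add_restrict_compl isClosed_diagonal.measurableSet, h1]

lemma map_snd_split (h2 : γ.map Prod.snd = ν) :
    ν = (γ.restrict (Set.diagonal ℝ)).map Prod.fst
      + (γ.restrict (Set.diagonal ℝ)ᶜ).map Prod.snd := by
  rw [map_fst_restrict_diagonal, ← Measure.map_add _ _ measurable_snd,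
    Measure.restrict_add_restrict_compl isClosed_diagonal.measurableSet, h2]

lemma map_fst_restrict_diagonal_le_inf (h1 : γ.map Prod.fst = μ) (h2 : γ.map Prod.snd = ν) :
    (γ.restrict (Set.diagonal ℝ)).map Prod.fst ≤ μ ⊓ ν := by
  refine le_inf ?_ ?_
  · conv_rhs => rw [map_fst_split h1]
    exact Measure.le_add_right le_rfl
  · conv_rhs => rw [map_snd_split h2]
    exact Measure.le_add_right le_rfl

/-- If no route ends where another one starts, then the common mass stays in place. -/
lemma inf_eq_of_no_chain (h1 : γ.map Prod.fst = μ) (h2 : γ.map Prod.snd = ν)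
    (hch : ∀ x t y, (x, t) ∈ γ.support → (t, y) ∈ γ.support → x ≠ t → t ≠ y → False) :
    μ ⊓ ν = (γ.restrict (Set.diagonal ℝ)).map Prod.fst := by
  refine le_antisymm ?_ (map_fst_restrict_diagonal_le_inf h1 h2)
  set A := γ.support ∩ (Set.diagonal ℝ)ᶜ with hA
  have hU : IsOpen (Set.diagonal ℝ)ᶜ := isClosed_diagonal.isOpen_compl
  have hP : MeasurableSet (Prod.fst '' A) :=
    measurableSet_image_closed_inter_open continuous_fst Measure.isClosed_support hU
  have hAae : ∀ᵐ z ∂(γ.restrict (Set.diagonal ℝ)ᶜ), z ∈ A := by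
    filter_upwards [ae_restrict_mem hU.measurableSet,
      ae_restrict_of_ae (Measure.support_mem_ae (μ := γ))] with z h h' using ⟨h', h⟩
  have e1 : (γ.restrict (Set.diagonal ℝ)ᶜ).map Prod.fst (Prod.fst '' A)ᶜ = 0 := by
    rw [Measure.map_apply measurable_fst hP.compl]
    refine measure_mono_null ?_ hAae
    intro z hz hzA
    exact hz ⟨z, hzA, rfl⟩
  -- A moving route that ended in the set of starting points would form a chain with another one.
  -- The two moving marginals thus live on complementary sets.
  have e2 : (γ.restrict (Set.diagonal ℝ)ᶜ).map Prod.snd (Prod.fst '' A) = 0 := by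
    rw [Measure.map_apply measurable_snd hP]
    refine measure_mono_null ?_ hAae
    rintro ⟨x, t⟩ ⟨⟨t', y⟩, hw, rfl⟩ hz
    exact hch x t' y hz.1 hw.1 hz.2 hw.2
  refine Measure.le_iff.2 fun B hB => ?_
  set α := (γ.restrict (Set.diagonal ℝ)).map Prod.fst
  -- Bound the infimum by `ν` on the starting points and by `μ` off them: each time the moving part
  -- vanishes.
  calc (μ ⊓ ν) B = (μ ⊓ ν) (B ∩ Prod.fst '' A) + (μ ⊓ ν) (B \ Prod.fst '' A) :=
        (measure_inter_add_sdiff B hP).symm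
    _ ≤ ν (B ∩ Prod.fst '' A) + μ (B \ Prod.fst '' A) :=
        add_le_add (inf_le_right (a := μ) _) (inf_le_left (b := ν) _)
    _ = α (B ∩ Prod.fst '' A) + α (B \ Prod.fst '' A) := by
        rw [map_fst_split h1, map_snd_split h2, Measure.add_apply, Measure.add_apply,
          measure_mono_null Set.inter_subset_right e2,
          measure_mono_null (Set.sdiff_subset_compl _ _) e1, add_zero, add_zero]
    _ = α B := measure_inter_add_sdiff B hP

end common

/-- Strictly concave costs leave the common mass in place. -/
lemma ConcaveProfile.inf_eq {g : ℝ → ℝ} (hg : ConcaveProfile g) {μ ν : Measure ℝ}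
    {π : ProbabilityMeasure (ℝ × ℝ)} (hπ : π ∈ Marg μ ν) (hfin : profileCost g π ≠ ∞)
    (hmin : ∀ γ ∈ Marg μ ν, profileCost g π ≤ profileCost g γ) :
    μ ⊓ ν = ((π : Measure (ℝ × ℝ)).restrict (Set.diagonal ℝ)).map Prod.fst := by
  have h0 := prod_improvable_eq_zero hg.continuous_abs (fun r => hg.nonneg (abs_nonneg r))
    hπ hfin hmin
  exact inf_eq_of_no_chain hπ.1 hπ.2 fun x t y h1 h2 hx hy =>
    notMem_of_mem_support (isOpen_improvable hg.continuous_abs) h0 h1 h2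
      (hg.mem_improvable_of_chain hx hy)

/-! ### Routes that cover an interval -/

/-- The routes from `]-∞, a]` to `]b, ∞[`. -/
def cover (a b : ℝ) : Set (ℝ × ℝ) := Set.Iic a ×ˢ Set.Ioi b

lemma mem_cover {a b : ℝ} {z : ℝ × ℝ} : z ∈ cover a b ↔ z.1 ≤ a ∧ b < z.2 := Iff.rfl

lemma measurableSet_cover (a b : ℝ) : MeasurableSet (cover a b) :=
  measurableSet_Iic.prod measurableSet_Ioi

/-- The routes to the right. -/
def rightward : Set (ℝ × ℝ) := {z | z.1 < z.2}

lemma mem_rightward {z : ℝ × ℝ} : z ∈ rightward ↔ z.1 < z.2 := Iff.rfl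

lemma measurableSet_rightward : MeasurableSet rightward :=
  measurableSet_lt measurable_fst measurable_snd

lemma cover_subset_rightward {a b : ℝ} (hab : a ≤ b) : cover a b ⊆ rightward :=
  fun _ hz => lt_of_le_of_lt hz.1 (lt_of_le_of_lt hab hz.2)

lemma iUnion_cover_eq_rightward : ⋃ q : ℚ, cover q q = rightward := by
  ext z
  simp only [Set.mem_iUnion, mem_cover, mem_rightward]
  constructor
  · rintro ⟨q, h1, h2⟩
    exact h1.trans_lt h2
  · intro h
    obtain ⟨q, h1, h2⟩ := exists_rat_btwn h
    exact ⟨q, h1.le, h2⟩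

/-- The sets of routes that cover an interval. -/
def covers : Set (Set (ℝ × ℝ)) := {s | ∃ a b : ℝ, a ≤ b ∧ s = cover a b}

lemma cover_inter_cover (a b a' b' : ℝ) :
    cover a b ∩ cover a' b' = cover (min a a') (max b b') := by
  ext z
  simp only [Set.mem_inter_iff, mem_cover, le_min_iff, max_lt_iff]
  tauto

lemma cover_inter_mem_covers {s t : Set (ℝ × ℝ)} (hs : s ∈ covers) (ht : t ∈ covers) :
    s ∩ t ∈ covers := by
  obtain ⟨a, b, hab, rfl⟩ := hs
  obtain ⟨a', b', -, rfl⟩ := ht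
  exact ⟨_, _, (min_le_left _ _).trans (hab.trans (le_max_left _ _)), cover_inter_cover _ _ _ _⟩

lemma isPiSystem_covers : IsPiSystem covers := fun _ hs _ ht _ => cover_inter_mem_covers hs ht

lemma measurableSet_inter_rightward {B : Set (ℝ × ℝ)} (hB : MeasurableSet B) :
    MeasurableSet[MeasurableSpace.generateFrom covers] (B ∩ rightward) := by
  set m := MeasurableSpace.generateFrom covers with hm
  have hc : ∀ a b : ℝ, a ≤ b → MeasurableSet[m] (cover a b) := fun a b hab =>
    MeasurableSpace.measurableSet_generateFrom ⟨a, b, hab, rfl⟩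
  have hU : MeasurableSet[m] rightward := by
    rw [← iUnion_cover_eq_rightward]
    exact MeasurableSet.iUnion fun q => hc q q le_rfl
  have h1 : ∀ a : ℝ, MeasurableSet[m] (Prod.fst ⁻¹' Set.Iic a ∩ rightward) := by
    intro a
    have : Prod.fst ⁻¹' Set.Iic a ∩ rightward = ⋃ q : ℚ, cover (min a q) q := by
      ext z
      simp only [Set.mem_inter_iff, Set.mem_preimage, Set.mem_Iic, mem_rightward, Set.mem_iUnion,
        mem_cover, le_min_iff]
      constructor
      · rintro ⟨h1, h2⟩
        obtain ⟨q, h3, h4⟩ := exists_rat_btwn h2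
        exact ⟨q, ⟨h1, h3.le⟩, h4⟩
      · rintro ⟨q, ⟨h1, h3⟩, h4⟩
        exact ⟨h1, h3.trans_lt h4⟩
    rw [this]
    exact MeasurableSet.iUnion fun q => hc _ _ (min_le_right _ _)
  have h2 : ∀ b : ℝ, MeasurableSet[m] (Prod.snd ⁻¹' Set.Ioi b ∩ rightward) := by
    intro b
    have : Prod.snd ⁻¹' Set.Ioi b ∩ rightward = ⋃ q : ℚ, cover q (max b q) := by
      ext z
      simp only [Set.mem_inter_iff, Set.mem_preimage, Set.mem_Ioi, mem_rightward, Set.mem_iUnion,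
        mem_cover, max_lt_iff]
      constructor
      · rintro ⟨h1, h2⟩
        obtain ⟨q, h3, h4⟩ := exists_rat_btwn h2
        exact ⟨q, h3.le, h1, h4⟩
      · rintro ⟨q, h3, h1, h4⟩
        exact ⟨h1, h3.trans_lt h4⟩
    rw [this]
    exact MeasurableSet.iUnion fun q => hc _ _ (le_max_right _ _)
  -- The sets whose trace on `rightward` is generated by `covers` form a σ-algebra, so it suffices
  -- that it contains the half-planes in each coordinate.
  let m' : MeasurableSpace (ℝ × ℝ) :=
    { MeasurableSet' := fun s => MeasurableSet[m] (s ∩ rightward)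
      measurableSet_empty := by simp
      measurableSet_compl := fun s hs => by
        have : sᶜ ∩ rightward = rightward \ (s ∩ rightward) := by
          ext z; simp only [Set.mem_inter_iff, Set.mem_compl_iff, Set.mem_sdiff]; tauto
        rw [this]
        exact MeasurableSet.diff hU hs
      measurableSet_iUnion := fun f hf => by
        rw [Set.iUnion_inter]
        exact MeasurableSet.iUnion hf }
  have hle : (Prod.instMeasurableSpace : MeasurableSpace (ℝ × ℝ)) ≤ m' := by
    change MeasurableSpace.comap Prod.fst (inferInstance : MeasurableSpace ℝ)
      ⊔ MeasurableSpace.comap Prod.snd (inferInstance : MeasurableSpace ℝ) ≤ m'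
    refine sup_le ?_ ?_
    · rw [← measurable_iff_comap_le]
      exact @measurable_of_Iic ℝ (ℝ × ℝ) _ _ _ m' _ _ _ _ h1
    · rw [← measurable_iff_comap_le]
      exact @measurable_of_Ioi ℝ (ℝ × ℝ) _ _ _ m' _ _ _ _ h2
  exact hle B hB

lemma generateFrom_covers_le :
    MeasurableSpace.generateFrom covers ≤ (Prod.instMeasurableSpace : MeasurableSpace (ℝ × ℝ)) := by
  refine MeasurableSpace.generateFrom_le ?_
  rintro _ ⟨a, b, -, rfl⟩
  exact measurableSet_cover a b

/-- A finite measure on the routes to the right is determined by its values on `covers`. -/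
lemma restrict_rightward_eq {γ γ' : Measure (ℝ × ℝ)} [IsFiniteMeasure γ] [IsFiniteMeasure γ']
    (h : ∀ a b, a ≤ b → γ (cover a b) = γ' (cover a b)) :
    γ.restrict rightward = γ'.restrict rightward := by
  -- The total masses are not known to agree, so the π-λ argument runs inside a fixed set `C` of the
  -- π-system, where they do.
  have key : ∀ C ∈ covers, ∀ s, MeasurableSet[MeasurableSpace.generateFrom covers] s →
      γ (s ∩ C) = γ' (s ∩ C) := by
    rintro C hC s hs
    have hCm : MeasurableSet C :=
      generateFrom_covers_le _ (MeasurableSpace.measurableSet_generateFrom hC)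
    induction s, hs using MeasurableSpace.induction_on_inter rfl isPiSystem_covers with
    | empty => simp
    | basic t ht =>
      obtain ⟨a, b, hab, e⟩ := cover_inter_mem_covers ht hC
      rw [e, h a b hab]
    | compl t ht ih =>
      obtain ⟨a, b, hab, rfl⟩ := hC
      have e : tᶜ ∩ cover a b = cover a b \ (t ∩ cover a b) := by
        ext z; simp only [Set.mem_inter_iff, Set.mem_compl_iff, Set.mem_sdiff]; tauto
      have hm := ((generateFrom_covers_le _ ht).inter hCm).nullMeasurableSet (μ := γ)
      have hm' := ((generateFrom_covers_le _ ht).inter hCm).nullMeasurableSet (μ := γ')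
      rw [e, measure_sdiff Set.inter_subset_right hm (measure_ne_top _ _),
        measure_sdiff Set.inter_subset_right hm' (measure_ne_top _ _), ih, h a b hab]
    | iUnion f hd hf ih =>
      have hd' : Pairwise (Function.onFun Disjoint fun i => f i ∩ C) := fun i j hij =>
        (hd hij).mono Set.inter_subset_left Set.inter_subset_left
      rw [Set.iUnion_inter, measure_iUnion hd' fun i => (generateFrom_covers_le _ (hf i)).inter hCm,
        measure_iUnion hd' fun i => (generateFrom_covers_le _ (hf i)).inter hCm]
      exact tsum_congr ih
  rw [← iUnion_cover_eq_rightward, Measure.restrict_iUnion_congr]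
  intro q
  ext B hB
  rw [Measure.restrict_apply hB, Measure.restrict_apply hB]
  have := key (cover q q) ⟨q, q, le_rfl, rfl⟩ _ (measurableSet_inter_rightward hB)
  rwa [Set.inter_assoc, Set.inter_eq_right.2 (cover_subset_rightward (le_refl (q : ℝ)))] at this

lemma preimage_swap_rightward_compl :
    (Set.diagonal ℝ)ᶜ = rightward ∪ Prod.swap ⁻¹' rightward := by
  ext z
  simp only [Set.mem_compl_iff, Set.mem_diagonal_iff, Set.mem_union, Set.mem_preimage,
    mem_rightward, Prod.fst_swap, Prod.snd_swap]
  exact ne_iff_lt_or_gt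

/-- A finite measure without mass on the diagonal is determined by the masses of the routes to the
right and to the left that cover an interval. -/
lemma ext_of_cover {γ γ' : Measure (ℝ × ℝ)} [IsFiniteMeasure γ] [IsFiniteMeasure γ']
    (h0 : γ (Set.diagonal ℝ) = 0) (h0' : γ' (Set.diagonal ℝ) = 0)
    (h : ∀ a b, a ≤ b → γ (cover a b) = γ' (cover a b))
    (hs : ∀ a b, a ≤ b → γ (Prod.swap ⁻¹' cover a b) = γ' (Prod.swap ⁻¹' cover a b)) :
    γ = γ' := by
  have h1 := restrict_rightward_eq h
  have h2 : (γ.map Prod.swap).restrict rightward = (γ'.map Prod.swap).restrict rightward := by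
    have := Measure.isFiniteMeasure_map γ Prod.swap
    have := Measure.isFiniteMeasure_map γ' Prod.swap
    refine restrict_rightward_eq fun a b hab => ?_
    rw [Measure.map_apply measurable_swap (measurableSet_cover a b),
      Measure.map_apply measurable_swap (measurableSet_cover a b), hs a b hab]
  rw [Measure.restrict_map measurable_swap measurableSet_rightward,
    Measure.restrict_map measurable_swap measurableSet_rightward] at h2
  have h3 := congrArg (Measure.map Prod.swap) h2
  rw [Measure.map_map measurable_swap measurable_swap,
    Measure.map_map measurable_swap measurable_swap, Prod.swap_swap_eq, Measure.map_id,
    Measure.map_id] at h3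
  have e : ∀ ρ : Measure (ℝ × ℝ), ρ (Set.diagonal ℝ) = 0 →
      ρ = ρ.restrict (rightward ∪ Prod.swap ⁻¹' rightward) := by
    intro ρ hρ
    rw [← preimage_swap_rightward_compl, Measure.restrict_eq_self_of_ae_mem]
    exact measure_eq_zero_iff_ae_notMem.1 hρ
  rw [e γ h0, e γ' h0', Measure.restrict_union_congr]
  exact ⟨h1, h3⟩

/-- A family of finite measures on the routes to the right is measurable if its values on `covers`
are. -/
lemma measurable_of_measurable_cover {α : Type*} [MeasurableSpace α]
    {ρ : α → Measure (ℝ × ℝ)} [∀ h, IsFiniteMeasure (ρ h)]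
    (h0 : ∀ h, ρ h rightwardᶜ = 0)
    (hC : ∀ a b, a ≤ b → Measurable fun h => ρ h (cover a b)) : Measurable ρ := by
  have key : ∀ C ∈ covers, ∀ s, MeasurableSet[MeasurableSpace.generateFrom covers] s →
      Measurable fun h => ρ h (s ∩ C) := by
    rintro C hC' s hs
    have hCm : MeasurableSet C :=
      generateFrom_covers_le _ (MeasurableSpace.measurableSet_generateFrom hC')
    induction s, hs using MeasurableSpace.induction_on_inter rfl isPiSystem_covers with
    | empty => simp
    | basic t ht =>
      obtain ⟨a, b, hab, e⟩ := cover_inter_mem_covers ht hC'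
      simp_rw [e]
      exact hC a b hab
    | compl t ht ih =>
      obtain ⟨a, b, hab, rfl⟩ := hC'
      have e : tᶜ ∩ cover a b = cover a b \ (t ∩ cover a b) := by
        ext z; simp only [Set.mem_inter_iff, Set.mem_compl_iff, Set.mem_sdiff]; tauto
      have : ∀ h, ρ h (tᶜ ∩ cover a b) = ρ h (cover a b) - ρ h (t ∩ cover a b) := fun h => by
        rw [e, measure_sdiff Set.inter_subset_right
          ((generateFrom_covers_le _ ht).inter hCm).nullMeasurableSet (measure_ne_top _ _)]
      simp_rw [this]
      exact (hC a b hab).sub ih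
    | iUnion f hd hf ih =>
      have hd' : Pairwise (Function.onFun Disjoint fun i => f i ∩ C) := fun i j hij =>
        (hd hij).mono Set.inter_subset_left Set.inter_subset_left
      simp_rw [Set.iUnion_inter,
        measure_iUnion hd' fun i => (generateFrom_covers_le _ (hf i)).inter hCm]
      exact Measurable.tsum ih
  refine Measure.measurable_of_measurable_coe _ fun B hB => ?_
  obtain ⟨e⟩ := nonempty_denumerable ℚ
  let q : ℕ → ℚ := (Denumerable.eqv ℚ).symm
  let c : ℕ → Set (ℝ × ℝ) := fun n => cover (q n) (q n)
  have hc : ⋃ n, c n = rightward := by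
    rw [← iUnion_cover_eq_rightward]
    exact (Denumerable.eqv ℚ).symm.surjective.iUnion_comp fun q : ℚ => cover q q
  have hcm : ∀ n, MeasurableSet (c n) := fun n => measurableSet_cover _ _
  have hdm : ∀ n, MeasurableSet (disjointed c n) := fun n => MeasurableSet.disjointed hcm n
  -- Cut the half-plane into countably many disjoint pieces, each contained in a single set of
  -- `covers`.
  have e1 : ∀ h, ρ h B = ∑' n, ρ h ((B ∩ disjointed c n ∩ rightward) ∩ c n) := by
    intro h
    have e2 : ρ h B = ρ h (B ∩ rightward) :=
      (measure_inter_conull (h0 h)).symm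
    rw [e2, ← hc, ← iUnion_disjointed, Set.inter_iUnion, measure_iUnion]
    · refine tsum_congr fun n => congrArg _ ?_
      have := disjointed_subset c n
      have h3 : c n ⊆ ⋃ i, disjointed c i := by
        rw [iUnion_disjointed]; exact Set.subset_iUnion c n
      ext z
      simp only [Set.mem_inter_iff]
      constructor
      · rintro ⟨hz, hz'⟩
        exact ⟨⟨⟨hz, hz'⟩, h3 (this hz')⟩, this hz'⟩
      · rintro ⟨⟨⟨hz, hz'⟩, -⟩, -⟩
        exact ⟨hz, hz'⟩
    · exact fun i j hij => (disjoint_disjointed c hij).mono Set.inter_subset_right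
        Set.inter_subset_right
    · exact fun n => hB.inter (hdm n)
  simp_rw [e1]
  exact Measurable.tsum fun n =>
    key _ ⟨q n, q n, le_rfl, rfl⟩ _ (measurableSet_inter_rightward (hB.inter (hdm n)))

/-! ### Plans without crossings -/

section crossings

variable {γ : Measure (ℝ × ℝ)} {Γ : Set (ℝ × ℝ)}

lemma exists_mem_of_measure_pos (hΓ : γ Γᶜ = 0) {s : Set (ℝ × ℝ)} (hs : γ s ≠ 0) :
    ∃ z ∈ s, z ∈ Γ := by
  by_contra! h
  exact hs (measure_mono_null (fun z hz => h z hz) hΓ)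

variable [IsFiniteMeasure γ]

/-- If every point of `[a, b]` is covered by a sizeable set of routes, then a sizeable set of
routes covers `[a, b]`. -/
lemma iInf_cover_le (hΓ : γ Γᶜ = 0)
    (hcr : ∀ z ∈ Γ, ∀ w ∈ Γ, ¬ (z.1 < w.1 ∧ w.1 < z.2 ∧ z.2 < w.2))
    (hat : ∀ c, γ {z | z.1 = c ∧ z.2 ≠ c} = 0 ∨ γ {z | z.1 ≠ c ∧ z.2 = c} = 0)
    {a b : ℝ} (hab : a ≤ b) {δ : ℝ≥0∞} (hδ : 0 < δ)
    (h : ∀ t ∈ Set.Icc a b, δ ≤ γ (cover t t \ cover a b)) : False := by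
  have hpos : ∀ t ∈ Set.Icc a b, γ (cover t t \ cover a b) ≠ 0 := fun t ht =>
    (hδ.trans_le (h t ht)).ne'
  -- The targets of routes that enter `[a, b]` from the left and stop inside. The contradiction
  -- arises at their supremum `c`.
  set S : Set ℝ := {y | ∃ x, (x, y) ∈ Γ ∧ x ≤ a ∧ a < y ∧ y ≤ b} with hS
  have hne : S.Nonempty := by
    obtain ⟨⟨x, y⟩, ⟨⟨h1, h2⟩, h3⟩, h4⟩ := exists_mem_of_measure_pos hΓ (hpos a ⟨le_rfl, hab⟩)
    exact ⟨y, x, h4, h1, h2, not_lt.1 fun hlt => h3 ⟨h1, hlt⟩⟩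
  have hbd : BddAbove S := ⟨b, by rintro y ⟨x, -, -, -, hy⟩; exact hy⟩
  set c := sSup S with hc
  obtain ⟨y₀, hy₀⟩ := hne
  have hac : a < c := by
    obtain ⟨x, -, -, h1, -⟩ := id hy₀
    exact h1.trans_le (le_csSup hbd hy₀)
  have hcb : c ≤ b := csSup_le ⟨y₀, hy₀⟩ (by rintro y ⟨x, -, -, -, hy⟩; exact hy)
  have hcIcc : c ∈ Set.Icc a b := ⟨hac.le, hcb⟩
  -- A route over `c` that does not cover `[a, b]` must start exactly at `c`. If it starts in `]-∞,
  -- a]`, its target is in `S` beyond the supremum; if it starts in `]a, c[`, it crosses a route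
  -- that ends in `S`.
  have hstart : ∀ z ∈ Γ, z ∈ cover c c → z ∉ cover a b → z.1 = c := by
    rintro ⟨x', y'⟩ hz ⟨h1, h2⟩ h3
    simp only [Set.mem_Iic, Set.mem_Ioi] at h1 h2
    by_contra hne
    have hlt : x' < c := lt_of_le_of_ne h1 hne
    obtain ⟨y, hy, hxy⟩ := exists_lt_of_lt_csSup ⟨y₀, hy₀⟩ hlt
    obtain ⟨x, hxΓ, hxa, hay, hyb⟩ := id hy
    have hyc : y ≤ c := le_csSup hbd hy
    rcases le_or_gt x' a with hx' | hx'
    · have hy'b : y' ≤ b := not_lt.1 fun hlt => h3 ⟨hx', hlt⟩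
      have : y' ∈ S := ⟨x', hz, hx', hac.trans h2, hy'b⟩
      exact absurd (le_csSup hbd this) (not_le.2 h2)
    · exact hcr _ hxΓ _ hz ⟨hxa.trans_lt hx', hxy, hyc.trans_lt h2⟩
  -- Mass departs from `c`, so by `hat` no mass arrives there from elsewhere.
  have hc0 : γ {z | z.1 ≠ c ∧ z.2 = c} = 0 := by
    refine (hat c).resolve_left fun h0 =>
      hpos c hcIcc (measure_mono_null ?_ (measure_union_null h0 hΓ))
    rintro z ⟨hz1, hz2⟩
    by_cases hz : z ∈ Γ
    · exact Or.inl ⟨hstart z hz hz1 hz2, (ne_of_gt hz1.2)⟩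
    · exact Or.inr hz
  obtain ⟨u, hu_mono, hu_lt, hu_lim⟩ := exists_seq_strictMono_tendsto' hac
  -- Routes over a point `u n < c` that do not cover `[a, b]` can neither pass `c` (by `hstart`) nor
  -- end at `c`. They end in `]u n, c[`, and these intervals shrink to the empty set while keeping
  -- mass at least `δ`.
  have hle : ∀ n, δ ≤ γ (Prod.snd ⁻¹' Set.Ioo (u n) c) := by
    intro n
    refine (h (u n) ⟨(hu_lt n).1.le, (hu_lt n).2.le.trans hcb⟩).trans ?_
    have : cover (u n) (u n) \ cover a b ⊆
        Prod.snd ⁻¹' Set.Ioo (u n) c ∪ ({z | z.1 ≠ c ∧ z.2 = c} ∪ Γᶜ) := by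
      rintro z ⟨hz1, hz2⟩
      by_cases hz : z ∈ Γ
      · rcases lt_trichotomy z.2 c with h1 | h1 | h1
        · exact Or.inl ⟨hz1.2, h1⟩
        · exact Or.inr (Or.inl ⟨(hz1.1.trans_lt (hu_lt n).2).ne, h1⟩)
        · exact absurd (hstart z hz ⟨hz1.1.trans (hu_lt n).2.le, h1⟩ hz2)
            (hz1.1.trans_lt (hu_lt n).2).ne
      · exact Or.inr (Or.inr hz)
    refine (measure_mono this).trans ((measure_union_le _ _).trans ?_)
    rw [measure_union_null hc0 hΓ, add_zero]
  have hlim : Tendsto (fun n => γ (Prod.snd ⁻¹' Set.Ioo (u n) c)) atTop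
      (𝓝 (γ (⋂ n, Prod.snd ⁻¹' Set.Ioo (u n) c))) := by
    refine tendsto_measure_iInter_atTop
      (fun n => (measurable_snd measurableSet_Ioo).nullMeasurableSet) ?_ ⟨0, measure_ne_top _ _⟩
    exact fun m n hmn => Set.preimage_mono (Set.Ioo_subset_Ioo_left (hu_mono.monotone hmn))
  have hempty : ⋂ n, Prod.snd ⁻¹' Set.Ioo (u n) c = (∅ : Set (ℝ × ℝ)) := by
    rw [Set.eq_empty_iff_forall_notMem]
    intro z hz
    have hz' : ∀ n, u n < z.2 ∧ z.2 < c := fun n => Set.mem_iInter.1 hz n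
    exact absurd (le_of_tendsto' hu_lim fun n => (hz' n).1.le) (not_le.2 (hz' 0).2)
  rw [hempty, measure_empty] at hlim
  exact absurd (ge_of_tendsto' hlim hle) (not_le.2 hδ)

lemma measure_cover_eq_iInf (hΓ : γ Γᶜ = 0)
    (hcr : ∀ z ∈ Γ, ∀ w ∈ Γ, ¬ (z.1 < w.1 ∧ w.1 < z.2 ∧ z.2 < w.2))
    (hat : ∀ c, γ {z | z.1 = c ∧ z.2 ≠ c} = 0 ∨ γ {z | z.1 ≠ c ∧ z.2 = c} = 0)
    {a b : ℝ} (hab : a ≤ b) :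
    γ (cover a b) = ⨅ t ∈ Set.Icc a b, γ (cover t t) := by
  have hsub : ∀ t ∈ Set.Icc a b, cover a b ⊆ cover t t := fun t ht z hz =>
    ⟨hz.1.trans ht.1, ht.2.trans_lt hz.2⟩
  refine le_antisymm (le_iInf₂ fun t ht => measure_mono (hsub t ht)) ?_
  by_contra hlt
  rw [not_le] at hlt
  refine iInf_cover_le hΓ hcr hat hab (tsub_pos_iff_lt.2 hlt) fun t ht => ?_
  rw [measure_sdiff (hsub t ht) (measurableSet_cover a b).nullMeasurableSet (measure_ne_top _ _)]
  exact tsub_le_tsub_right (iInf₂_le t ht) _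

/-- If routes in opposite directions do not overlap, the flux through `t` is given by the
distribution function of `μ - ν`. -/
lemma measure_cover_self {μ ν : Measure ℝ} (h1 : γ.map Prod.fst = μ) (h2 : γ.map Prod.snd = ν)
    (hΓ : γ Γᶜ = 0)
    (hop : ∀ z ∈ Γ, ∀ w ∈ Γ, ∀ t, z ∈ cover t t → w.swap ∉ cover t t) (t : ℝ) :
    γ (cover t t) = ENNReal.ofReal (cdfDiff μ ν t) := by
  set R := γ (cover t t)
  set L := γ (Prod.swap ⁻¹' cover t t)
  -- The net flux `R - L` through `t` is the difference of the distribution functions. One of the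
  -- two terms vanishes, so `R` is its positive part.
  have hRL : R = 0 ∨ L = 0 := by
    by_contra! h
    obtain ⟨z, hz, hzΓ⟩ := exists_mem_of_measure_pos hΓ h.1
    obtain ⟨w, hw, hwΓ⟩ := exists_mem_of_measure_pos hΓ h.2
    exact hop z hzΓ w hwΓ t hz hw
  set B := γ (Set.Iic t ×ˢ Set.Iic t)
  have hm : MeasurableSet (Prod.snd ⁻¹' Set.Iic t : Set (ℝ × ℝ)) := measurable_snd measurableSet_Iic
  have hm' : MeasurableSet (Prod.fst ⁻¹' Set.Iic t : Set (ℝ × ℝ)) :=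
    measurable_fst measurableSet_Iic
  have e1 : μ (Set.Iic t) = B + R := by
    rw [← h1, Measure.map_apply measurable_fst measurableSet_Iic,
      ← measure_inter_add_sdiff _ hm]
    congr 2
    ext z
    simp [cover]
  have e2 : ν (Set.Iic t) = B + L := by
    rw [← h2, Measure.map_apply measurable_snd measurableSet_Iic,
      ← measure_inter_add_sdiff _ hm']
    congr 2 <;> ext z <;> simp only [Set.mem_inter_iff, Set.mem_preimage, Set.mem_Iic,
      Set.mem_prod, Set.mem_sdiff, cover, Set.mem_Ioi, Prod.fst_swap, Prod.snd_swap, not_le]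
    · tauto
  have hB : B ≠ ∞ := measure_ne_top _ _
  have hR : R ≠ ∞ := measure_ne_top _ _
  have hL : L ≠ ∞ := measure_ne_top _ _
  rw [cdfDiff, Measure.real, Measure.real, e1, e2, ENNReal.toReal_add hB hR,
    ENNReal.toReal_add hB hL, add_sub_add_left_eq_sub]
  rcases hRL with h | h
  · rw [h, ENNReal.toReal_zero, zero_sub, ENNReal.ofReal_of_nonpos (by simp)]
  · rw [h, ENNReal.toReal_zero, sub_zero, ENNReal.ofReal_toReal hR]

end crossings

lemma cdfDiff_swap (μ ν : Measure ℝ) (t : ℝ) : cdfDiff ν μ t = -cdfDiff μ ν t := by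
  simp [cdfDiff]

/-! ### Level sets of completed graphs -/

/-- Right-continuous functions with left limits that vanish at infinity and whose oscillation is
controlled by the measure `κ`. -/
structure IsRegulated (F : ℝ → ℝ) (κ : Measure ℝ) : Prop where
  right : ∀ x, Tendsto F (𝓝[>] x) (𝓝 (F x))
  left : ∀ x, Tendsto F (𝓝[<] x) (𝓝 (Function.leftLim F x))
  atTop : Tendsto F atTop (𝓝 0)
  atBot : Tendsto F atBot (𝓝 0)
  osc : ∀ a b, ∃ l, ∀ t ∈ Set.Ioc a b, F t ∈ Set.Icc l (l + (κ (Set.Ioc a b)).toReal)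

/-- The generalized solutions of `F = h`. -/
def level (F : ℝ → ℝ) (h : ℝ) : Set ℝ := {t | (t, h) ∈ genGraph F}

lemma mem_level {F : ℝ → ℝ} {h t : ℝ} :
    t ∈ level F h ↔ h ∈ Set.uIcc (Function.leftLim F t) (F t) := Iff.rfl

lemma lt_of_mem_uIcc_of_notMem_level {F : ℝ → ℝ} {h t k : ℝ} (ht : t ∉ level F h) (hF : h < F t)
    (hk : k ∈ Set.uIcc (Function.leftLim F t) (F t)) : h < k := by
  by_contra! hle
  exact ht (Set.uIcc_subset_uIcc hk Set.right_mem_uIcc (Set.mem_uIcc_of_le hle hF.le))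

lemma lt_of_mem_uIcc_of_notMem_level' {F : ℝ → ℝ} {h t k : ℝ} (ht : t ∉ level F h) (hF : F t < h)
    (hk : k ∈ Set.uIcc (Function.leftLim F t) (F t)) : k < h := by
  by_contra! hle
  exact ht (Set.uIcc_subset_uIcc Set.right_mem_uIcc hk (Set.mem_uIcc_of_le hF.le hle))

lemma ne_of_notMem_level {F : ℝ → ℝ} {h t : ℝ} (ht : t ∉ level F h) : F t ≠ h := fun e =>
  ht (mem_level.2 (e ▸ Set.right_mem_uIcc))

/-- The levels that are attained in `]a, b]`. -/
def hit (F : ℝ → ℝ) (a b : ℝ) : Set ℝ := {h | ∃ t ∈ Set.Ioc a b, t ∈ level F h}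

namespace IsRegulated

variable {F : ℝ → ℝ} {κ : Measure ℝ} (hF : IsRegulated F κ)
include hF

lemma leftLim_neg (x : ℝ) : Function.leftLim (fun t => -F t) x = -Function.leftLim F x :=
  leftLim_eq_of_tendsto (hF.left x).neg

lemma neg : IsRegulated (fun t => -F t) κ where
  right x := (hF.right x).neg
  left x := by rw [hF.leftLim_neg]; exact (hF.left x).neg
  atTop := by simpa using hF.atTop.neg
  atBot := by simpa using hF.atBot.neg
  osc a b := by
    obtain ⟨l, hl⟩ := hF.osc a b
    refine ⟨-(l + (κ (Set.Ioc a b)).toReal), fun t ht => ?_⟩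
    have := hl t ht
    rw [Set.mem_Icc] at this ⊢
    constructor <;> linarith

lemma mem_genGraph_neg {t h : ℝ} : (t, -h) ∈ genGraph (fun t => -F t) ↔ (t, h) ∈ genGraph F := by
  change -h ∈ Set.uIcc (Function.leftLim (fun t => -F t) t) (-F t) ↔
    h ∈ Set.uIcc (Function.leftLim F t) (F t)
  rw [hF.leftLim_neg, Set.mem_uIcc, Set.mem_uIcc]
  constructor <;> rintro (h | h)
  · exact Or.inr ⟨by linarith [h.2], by linarith [h.1]⟩
  · exact Or.inl ⟨by linarith [h.2], by linarith [h.1]⟩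
  · exact Or.inr ⟨by linarith [h.2], by linarith [h.1]⟩
  · exact Or.inl ⟨by linarith [h.2], by linarith [h.1]⟩

lemma level_neg (h : ℝ) : level (fun t => -F t) (-h) = level F h := by
  ext t
  exact hF.mem_genGraph_neg

/-- The intermediate value theorem to the right of `a`. -/
lemma lt_of_notMem_level_Ioc {a b h : ℝ} (hab : a ≤ b) (ha : h < F a)
    (hl : ∀ t ∈ Set.Ioc a b, t ∉ level F h) : h < F b := by
  by_contra! hb
  set T : Set ℝ := {t | t ∈ Set.Icc a b ∧ F t ≤ h} with hT
  have hTne : T.Nonempty := ⟨b, ⟨hab, le_rfl⟩, hb⟩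
  have hTbd : BddBelow T := ⟨a, fun t ht => ht.1.1⟩
  set s := sInf T
  have has : a ≤ s := le_csInf hTne fun t ht => ht.1.1
  have hsb : s ≤ b := csInf_le hTbd ⟨⟨hab, le_rfl⟩, hb⟩
  have hlow : ∀ t, a ≤ t → t < s → h < F t := fun t hat hts => by
    by_contra! hle
    exact absurd (csInf_le hTbd ⟨⟨hat, hts.le.trans hsb⟩, hle⟩) (not_le.2 hts)
  -- The left limit at `s` is at least `h` and the vertical segment over `s` misses `h`, so `F`
  -- stays above `h` at `s`. Right continuity then contradicts the choice of `s` as an infimum.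
  have hs : h < F s := by
    rcases has.eq_or_lt with e | hlt
    · rwa [← e]
    · have hns := hl s ⟨hlt, hsb⟩
      have hL : h ≤ Function.leftLim F s := by
        refine ge_of_tendsto (hF.left s) ?_
        filter_upwards [Ioo_mem_nhdsLT hlt] with t ht using (hlow t ht.1.le ht.2).le
      by_contra! hle
      exact hns (mem_level.2 (Set.mem_uIcc_of_ge hle hL))
  have hev := (hF.right s).eventually (lt_mem_nhds hs)
  obtain ⟨u, hu, hsu⟩ := (mem_nhdsGT_iff_exists_Ioo_subset.1 hev)
  obtain ⟨t, ht, htu⟩ := exists_lt_of_csInf_lt hTne (show sInf T < u from hu)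
  rcases (csInf_le hTbd ht).eq_or_lt with e | hlt
  · exact absurd ht.2 (not_le.2 (by rw [← e]; exact hs))
  · exact absurd ht.2 (not_le.2 (hsu ⟨hlt, htu⟩))

lemma gt_of_notMem_level_Ioc {a b h : ℝ} (hab : a ≤ b) (ha : F a < h)
    (hl : ∀ t ∈ Set.Ioc a b, t ∉ level F h) : F b < h := by
  have := hF.neg.lt_of_notMem_level_Ioc (h := -h) hab (neg_lt_neg ha)
    fun t ht => by rw [hF.level_neg]; exact hl t ht
  linarith

/-- On an interval without generalized solutions, `F - h` does not change sign. -/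
lemma lt_iff_of_notMem_level {I : Set ℝ} (hI : I.OrdConnected) {h : ℝ}
    (hl : ∀ t ∈ I, t ∉ level F h) {s t : ℝ} (hs : s ∈ I) (ht : t ∈ I) : h < F s ↔ h < F t := by
  have key : ∀ {s t : ℝ}, s ∈ I → t ∈ I → s ≤ t → (h < F s ↔ h < F t) := by
    intro s t hs ht hst
    have hl' : ∀ u ∈ Set.Ioc s t, u ∉ level F h := fun u hu =>
      hl u (hI.out hs ht ⟨hu.1.le, hu.2⟩)
    refine ⟨fun h1 => hF.lt_of_notMem_level_Ioc hst h1 hl', fun h1 => ?_⟩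
    by_contra! h2
    exact absurd h1 (hF.gt_of_notMem_level_Ioc hst
      (lt_of_le_of_ne h2 (ne_of_notMem_level (hl s hs))) hl').not_gt
  rcases le_total s t with hst | hst
  · exact key hs ht hst
  · exact (key ht hs hst).symm

/-- An intermediate value property of the completed graph. It gives measurability, and with the
oscillation bound it controls the length. -/
lemma ordConnected_hit (a b : ℝ) : (hit F a b).OrdConnected := by
  refine ⟨?_⟩
  rintro h₁ ⟨t₁, ht₁, hl₁⟩ h₂ ⟨t₂, ht₂, hl₂⟩ h ⟨hle₁, hle₂⟩
  by_contra hno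
  have hl : ∀ t ∈ Set.Ioc a b, t ∉ level F h := fun t ht hlt => hno ⟨t, ht, hlt⟩
  have hiff := hF.lt_iff_of_notMem_level Set.ordConnected_Ioc hl ht₁ ht₂
  rcases lt_or_gt_of_ne (ne_of_notMem_level (hl t₁ ht₁)) with h1 | h1
  · have h2 : F t₂ < h := lt_of_le_of_ne (not_lt.1 fun h2 => absurd (hiff.2 h2) h1.not_gt)
      (ne_of_notMem_level (hl t₂ ht₂))
    exact absurd (lt_of_mem_uIcc_of_notMem_level' (hl t₂ ht₂) h2 hl₂) (not_lt.2 hle₂)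
  · exact absurd (lt_of_mem_uIcc_of_notMem_level (hl t₁ ht₁) h1 hl₁) (not_lt.2 hle₁)

lemma measurableSet_hit (a b : ℝ) : MeasurableSet (hit F a b) :=
  (hF.ordConnected_hit a b).measurableSet

lemma volume_hit_le [IsFiniteMeasure κ] (a b : ℝ) : volume (hit F a b) ≤ κ (Set.Ioc a b) := by
  obtain ⟨l, hl⟩ := hF.osc a b
  have : hit F a b ⊆ Set.Icc l (l + (κ (Set.Ioc a b)).toReal) := by
    rintro h ⟨t, ht, hlt⟩
    refine Set.OrdConnected.uIcc_subset Set.ordConnected_Icc ?_ (hl t ht) hlt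
    refine isClosed_Icc.mem_of_tendsto (hF.left t) ?_
    filter_upwards [Ioo_mem_nhdsLT ht.1] with u hu using hl u ⟨hu.1, hu.2.le.trans ht.2⟩
  refine (measure_mono this).trans ?_
  rw [Real.volume_Icc, add_sub_cancel_left, ENNReal.ofReal_toReal (measure_ne_top _ _)]

end IsRegulated

/-! ### Counting the solutions at a level: the Banach indicatrix. -/

/-- The number of intervals of length `1 / (n + 1)` in which the level `h` is attained. -/
noncomputable def hitCount (F : ℝ → ℝ) (n : ℕ) (h : ℝ) : ℝ≥0∞ :=
  ∑' k : ℤ, (hit F ((k - 1) / (n + 1)) (k / (n + 1))).indicator 1 h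

lemma mem_hit_iff {F : ℝ → ℝ} {n : ℕ} {h : ℝ} {k : ℤ} :
    h ∈ hit F ((k - 1) / (n + 1)) (k / (n + 1)) ↔
      k ∈ (fun t : ℝ => ⌈(n + 1 : ℝ) * t⌉) '' level F h := by
  have hn : (0 : ℝ) < n + 1 := by positivity
  refine exists_congr fun t => ?_
  rw [and_comm, Set.mem_Ioc, div_lt_iff₀ hn, le_div_iff₀ hn, Int.ceil_eq_iff, mul_comm t]

lemma hitCount_eq (F : ℝ → ℝ) (n : ℕ) (h : ℝ) :
    hitCount F n h = (((fun t : ℝ => ⌈(n + 1 : ℝ) * t⌉) '' level F h).encard : ℝ≥0∞) := by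
  rw [← ENNReal.tsum_set_one, tsum_subtype _ fun _ => (1 : ℝ≥0∞), hitCount]
  refine tsum_congr fun k => ?_
  by_cases hk : k ∈ (fun t : ℝ => ⌈(n + 1 : ℝ) * t⌉) '' level F h
  · rw [Set.indicator_of_mem hk, Set.indicator_of_mem (mem_hit_iff.2 hk), Pi.one_apply]
  · rw [Set.indicator_of_notMem hk, Set.indicator_of_notMem (mt mem_hit_iff.1 hk)]

lemma eventually_injOn_ceil {s : Set ℝ} (hs : s.Finite) :
    ∀ᶠ n : ℕ in atTop, Set.InjOn (fun t : ℝ => ⌈(n + 1 : ℝ) * t⌉) s := by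
  have : ∀ x ∈ s, ∀ y ∈ s, ∀ᶠ n : ℕ in atTop,
      ⌈(n + 1 : ℝ) * x⌉ = ⌈(n + 1 : ℝ) * y⌉ → x = y := by
    intro x _ y _
    rcases eq_or_ne x y with rfl | hne
    · exact Eventually.of_forall fun _ _ => rfl
    · obtain ⟨m, hm⟩ := exists_nat_gt (1 / |x - y|)
      filter_upwards [eventually_ge_atTop m] with n hn he
      have h0 : 0 < |x - y| := abs_pos.2 (sub_ne_zero.2 hne)
      have h1 : |(n + 1 : ℝ) * x - (n + 1) * y| < 1 := by
        have a1 := Int.ceil_lt_add_one ((n + 1 : ℝ) * x)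
        have a2 := Int.le_ceil ((n + 1 : ℝ) * x)
        have a3 := Int.ceil_lt_add_one ((n + 1 : ℝ) * y)
        have a4 := Int.le_ceil ((n + 1 : ℝ) * y)
        rw [he] at a1 a2
        rw [abs_lt]
        constructor <;> linarith
      rw [← mul_sub, abs_mul, abs_of_pos (by positivity : (0 : ℝ) < n + 1)] at h1
      rw [div_lt_iff₀ h0] at hm
      have : (m : ℝ) ≤ n := by exact_mod_cast hn
      nlinarith
  have h2 := (Set.Finite.eventually_all hs).2 fun x hx =>
    (Set.Finite.eventually_all hs).2 fun y hy => this x hx y hy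
  filter_upwards [h2] with n hn x hx y hy he using hn x hx y hy he

/-- The number of occupied cells never exceeds the number of solutions, and a fine grid separates
any finite set of them. A lower limit is enough and suits Fatou's lemma. -/
lemma liminf_hitCount (F : ℝ → ℝ) (h : ℝ) :
    liminf (fun n => hitCount F n h) atTop = ((level F h).encard : ℝ≥0∞) := by
  refine le_antisymm ?_ ?_
  · refine liminf_le_of_frequently_le' (Frequently.of_forall fun n => ?_)
    rw [hitCount_eq]
    exact ENat.toENNReal_le.2 (Set.encard_image_le _ _)
  · have key : ∀ j : ℕ, (j : ℕ∞) ≤ (level F h).encard →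
        (j : ℝ≥0∞) ≤ liminf (fun n => hitCount F n h) atTop := by
      intro j hj
      obtain ⟨t, ht, htj⟩ := Set.exists_subset_encard_eq hj
      have htf : t.Finite := Set.finite_of_encard_eq_coe htj
      refine le_liminf_of_le (by isBoundedDefault) ?_
      filter_upwards [eventually_injOn_ceil htf] with n hn
      rw [hitCount_eq, ← ENat.toENNReal_coe, ENat.toENNReal_le, ← htj, ← hn.encard_image]
      exact Set.encard_le_encard (Set.image_mono ht)
    by_cases hfin : (level F h).Finite
    · rw [hfin.encard_eq_coe, ENat.toENNReal_coe]
      exact key _ hfin.encard_eq_coe.ge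
    · rw [Set.Infinite.encard_eq hfin, ENat.toENNReal_top]
      refine ENNReal.eq_top_of_forall_nnreal_le (fun r => ?_) |>.ge
      obtain ⟨j, hj⟩ := exists_nat_ge r
      refine le_trans ?_ (key j (by rw [Set.Infinite.encard_eq hfin]; exact le_top))
      exact_mod_cast hj

namespace IsRegulated

variable {F : ℝ → ℝ} {κ : Measure ℝ} (hF : IsRegulated F κ)
include hF

lemma measurable_hitCount (n : ℕ) : Measurable (hitCount F n) :=
  Measurable.tsum fun _ => measurable_one.indicator (hF.measurableSet_hit _ _)

lemma measurable_encard_level : Measurable fun h => ((level F h).encard : ℝ≥0∞) := by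
  simp_rw [← liminf_hitCount]
  exact Measurable.liminf hF.measurable_hitCount

lemma lintegral_hitCount_le [IsFiniteMeasure κ] (n : ℕ) :
    ∫⁻ h, hitCount F n h ≤ κ Set.univ := by
  have hn : (0 : ℝ) < n + 1 := by positivity
  simp only [hitCount]
  rw [lintegral_tsum fun k =>
    (measurable_one.indicator (hF.measurableSet_hit _ _)).aemeasurable]
  have : ∀ k : ℤ, ∫⁻ h, (hit F ((k - 1) / (n + 1)) (k / (n + 1))).indicator 1 h
      ≤ κ (Set.Ioc ((k - 1) / (n + 1)) (k / (n + 1))) := fun k => by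
    rw [lintegral_indicator_one (hF.measurableSet_hit _ _)]
    exact hF.volume_hit_le _ _
  refine (ENNReal.tsum_le_tsum this).trans ?_
  rw [← measure_iUnion _ fun k => measurableSet_Ioc]
  · exact measure_mono (Set.subset_univ _)
  · intro i j hij
    refine Set.disjoint_left.2 fun t hi hj => hij ?_
    rw [Set.mem_Ioc, div_lt_iff₀ hn, le_div_iff₀ hn] at hi hj
    have h1 : ⌈t * (n + 1)⌉ = i := Int.ceil_eq_iff.2 hi
    have h2 : ⌈t * (n + 1)⌉ = j := Int.ceil_eq_iff.2 hj
    exact h1.symm.trans h2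

/-- Banach's bound of the mean number of solutions by the variation: each cell contributes a length
at most its `κ`-mass, and Fatou's lemma passes to the limit. -/
lemma lintegral_encard_level_le [IsFiniteMeasure κ] :
    ∫⁻ h, ((level F h).encard : ℝ≥0∞) ≤ κ Set.univ := by
  simp_rw [← liminf_hitCount]
  refine (lintegral_liminf_le hF.measurable_hitCount).trans ?_
  exact liminf_le_of_frequently_le' (Frequently.of_forall hF.lintegral_hitCount_le)

lemma ae_finite_level [IsFiniteMeasure κ] : ∀ᵐ h, (level F h).Finite := by
  have h1 := hF.lintegral_encard_level_le
  filter_upwards [ae_lt_top hF.measurable_encard_level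
    (ne_top_of_le_ne_top (measure_ne_top κ _) h1)]
    with h hh
  rw [← ENat.toENNReal_top, ENat.toENNReal_lt] at hh
  exact Set.encard_lt_top_iff.1 hh

end IsRegulated

/-! ### Generic levels -/

/-- The infima and suprema of `F` over rational intervals. -/
def extremalLevels (F : ℝ → ℝ) : Set ℝ :=
  {h | ∃ r s : ℚ, IsGLB (F '' Set.Ioo (r : ℝ) s) h ∨ IsLUB (F '' Set.Ioo (r : ℝ) s) h}

lemma countable_extremalLevels (F : ℝ → ℝ) : (extremalLevels F).Countable := by
  have : extremalLevels F = ⋃ r : ℚ, ⋃ s : ℚ,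
      ({h | IsGLB (F '' Set.Ioo (r : ℝ) s) h} ∪ {h | IsLUB (F '' Set.Ioo (r : ℝ) s) h}) := by
    ext h
    simp [extremalLevels]
  rw [this]
  refine Set.countable_iUnion fun r => Set.countable_iUnion fun s => Set.Countable.union ?_ ?_
  · exact Set.Subsingleton.countable fun _ h1 _ h2 => IsGLB.unique h1 h2
  · exact Set.Subsingleton.countable fun _ h1 _ h2 => IsLUB.unique h1 h2

/-- The levels that are attained finitely often and are not extremal. -/
def genericLevels (F : ℝ → ℝ) : Set ℝ := {h | (level F h).Finite ∧ h ∉ extremalLevels F}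

/-- The completed graph crosses the level `h` at `x`, and does not meet it elsewhere in
`[r, s]`. -/
structure Crosses (F : ℝ → ℝ) (h x r s : ℝ) : Prop where
  left : r < x
  right : x < s
  notMem : ∀ t ∈ Set.Icc r s, t ≠ x → t ∉ level F h
  sign : (F r < h ∧ h < F s) ∨ (h < F r ∧ F s < h)

lemma disjoint_incPoints_decPoints (F : ℝ → ℝ) (h : ℝ) :
    Disjoint {x | (x, h) ∈ incPoints F} {x | (x, h) ∈ decPoints F} := by
  refine Set.disjoint_left.2 ?_
  rintro x ⟨-, U, hU, h1⟩ ⟨-, V, hV, h2⟩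
  have hev : ∀ᶠ t in 𝓝[>] x, t ∈ U ∩ V := nhdsWithin_le_nhds (inter_mem hU hV)
  obtain ⟨t, ⟨htU, htV⟩, htx⟩ := (hev.and self_mem_nhdsWithin).exists
  have hg : (t, F t) ∈ genGraph F := Set.right_mem_uIcc (a := Function.leftLim F t)
  have hne : t ≠ x := ne_of_gt htx
  exact absurd (h1 _ hg ⟨htU, hne⟩) (h2 _ hg ⟨htV, hne⟩).not_gt

namespace IsRegulated

variable {F : ℝ → ℝ} {κ : Measure ℝ} (hF : IsRegulated F κ)
include hF

lemma measurableSet_genericLevels : MeasurableSet (genericLevels F) := by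
  have : genericLevels F = {h | ((level F h).encard : ℝ≥0∞) < ∞} ∩ (extremalLevels F)ᶜ := by
    ext h
    rw [Set.mem_inter_iff, Set.mem_ofPred_eq, ← ENat.toENNReal_top, ENat.toENNReal_lt,
      Set.encard_lt_top_iff]
    rfl
  rw [this]
  exact (measurableSet_lt hF.measurable_encard_level measurable_const).inter
    (countable_extremalLevels F).measurableSet.compl

lemma ae_mem_genericLevels [IsFiniteMeasure κ] : ∀ᵐ h, h ∈ genericLevels F := by
  filter_upwards [hF.ae_finite_level, (countable_extremalLevels F).ae_notMem volume]
    with h h1 h2 using ⟨h1, h2⟩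

lemma gt_iff_of_notMem_level {I : Set ℝ} (hI : I.OrdConnected) {h : ℝ}
    (hl : ∀ t ∈ I, t ∉ level F h) {s t : ℝ} (hs : s ∈ I) (ht : t ∈ I) : F s < h ↔ F t < h := by
  have := hF.lt_iff_of_notMem_level hI hl hs ht
  have h1 := ne_of_notMem_level (hl s hs)
  have h2 := ne_of_notMem_level (hl t ht)
  constructor
  · exact fun h3 => lt_of_le_of_ne (not_lt.1 fun h4 => absurd (this.2 h4) h3.not_gt) h2
  · exact fun h3 => lt_of_le_of_ne (not_lt.1 fun h4 => absurd (this.1 h4) h3.not_gt) h1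

/-- At a jump, `h` may be reached only as a left limit. It is still the infimum, because every lower
bound of the values also bounds `F x` and the left limit at `x`. -/
lemma isGLB_of_forall_lt {h x r s : ℝ} (hx : x ∈ level F h) (hr : r < x) (hs : x < s)
    (h1 : ∀ t ∈ Set.Ioo r x, h < F t) (h2 : ∀ t ∈ Set.Ioo x s, h < F t) :
    IsGLB (F '' Set.Ioo r s) h := by
  have hFx : h ≤ F x := by
    refine ge_of_tendsto (hF.right x) ?_
    filter_upwards [Ioo_mem_nhdsGT hs] with t ht using (h2 t ht).le
  constructor
  · rintro _ ⟨t, ht, rfl⟩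
    rcases lt_trichotomy t x with h | rfl | h
    · exact (h1 t ⟨ht.1, h⟩).le
    · exact hFx
    · exact (h2 t ⟨h, ht.2⟩).le
  · intro k hk
    have hkt : ∀ t ∈ Set.Ioo r s, k ≤ F t := fun t ht => hk ⟨t, ht, rfl⟩
    have hkx : k ≤ F x := hkt x ⟨hr, hs⟩
    have hkL : k ≤ Function.leftLim F x := by
      refine ge_of_tendsto (hF.left x) ?_
      filter_upwards [Ioo_mem_nhdsLT hr] with t ht using hkt t ⟨ht.1, ht.2.trans hs⟩
    exact (le_min hkL hkx).trans (mem_level.1 hx).1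

lemma isLUB_of_forall_gt {h x r s : ℝ} (hx : x ∈ level F h) (hr : r < x) (hs : x < s)
    (h1 : ∀ t ∈ Set.Ioo r x, F t < h) (h2 : ∀ t ∈ Set.Ioo x s, F t < h) :
    IsLUB (F '' Set.Ioo r s) h := by
  have hFx : F x ≤ h := by
    refine le_of_tendsto (hF.right x) ?_
    filter_upwards [Ioo_mem_nhdsGT hs] with t ht using (h2 t ht).le
  constructor
  · rintro _ ⟨t, ht, rfl⟩
    rcases lt_trichotomy t x with h | rfl | h
    · exact (h1 t ⟨ht.1, h⟩).le
    · exact hFx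
    · exact (h2 t ⟨h, ht.2⟩).le
  · intro k hk
    have hkt : ∀ t ∈ Set.Ioo r s, F t ≤ k := fun t ht => hk ⟨t, ht, rfl⟩
    have hkx : F x ≤ k := hkt x ⟨hr, hs⟩
    have hkL : Function.leftLim F x ≤ k := by
      refine le_of_tendsto (hF.left x) ?_
      filter_upwards [Ioo_mem_nhdsLT hr] with t ht using hkt t ⟨ht.1, ht.2.trans hs⟩
    exact (mem_level.1 hx).2.trans (max_le hkL hkx)

/-- At a generic level, every generalized solution is a crossing. -/
lemma exists_crosses {h x : ℝ} (hh : h ∈ genericLevels F) (hx : x ∈ level F h) :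
    ∃ r s, Crosses F h x r s := by
  -- Finiteness isolates `x`, and rational end points make the countable family of extremal levels
  -- applicable.
  have hU : (level F h \ {x})ᶜ ∈ 𝓝 x :=
    (hh.1.subset Set.sdiff_subset).isClosed.isOpen_compl.mem_nhds fun hx' => hx'.2 rfl
  obtain ⟨l, u, ⟨hlx, hxu⟩, hlu⟩ := mem_nhds_iff_exists_Ioo_subset.1 hU
  obtain ⟨r, hlr, hrx⟩ := exists_rat_btwn hlx
  obtain ⟨s, hxs, hsu⟩ := exists_rat_btwn hxu
  have hno : ∀ t ∈ Set.Icc (r : ℝ) s, t ≠ x → t ∉ level F h := fun t ht hne hl =>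
    hlu ⟨hlr.trans_le ht.1, ht.2.trans_lt hsu⟩ ⟨hl, hne⟩
  have hnoL : ∀ t ∈ Set.Ico (r : ℝ) x, t ∉ level F h := fun t ht =>
    hno t ⟨ht.1, ht.2.le.trans hxs.le⟩ ht.2.ne
  have hnoR : ∀ t ∈ Set.Ioc x (s : ℝ), t ∉ level F h := fun t ht =>
    hno t ⟨hrx.le.trans ht.1.le, ht.2⟩ ht.1.ne'
  have hrI : (r : ℝ) ∈ Set.Ico (r : ℝ) x := ⟨le_rfl, hrx⟩
  have hsI : (s : ℝ) ∈ Set.Ioc x (s : ℝ) := ⟨hxs, le_rfl⟩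
  refine ⟨r, s, hrx, hxs, hno, ?_⟩
  -- Equal signs on both sides would make `h` the supremum or the infimum over `]r, s[`, which a
  -- generic level is not.
  rcases lt_or_gt_of_ne (ne_of_notMem_level (hnoL r hrI)) with hr | hr <;>
    rcases lt_or_gt_of_ne (ne_of_notMem_level (hnoR s hsI)) with hs | hs
  · refine absurd ⟨r, s, Or.inr (hF.isLUB_of_forall_gt hx hrx hxs ?_ ?_)⟩ hh.2
    · exact fun t ht => (hF.gt_iff_of_notMem_level Set.ordConnected_Ico hnoL hrI
        ⟨ht.1.le, ht.2⟩).1 hr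
    · exact fun t ht => (hF.gt_iff_of_notMem_level Set.ordConnected_Ioc hnoR hsI
        ⟨ht.1, ht.2.le⟩).1 hs
  · exact Or.inl ⟨hr, hs⟩
  · exact Or.inr ⟨hr, hs⟩
  · refine absurd ⟨r, s, Or.inl (hF.isGLB_of_forall_lt hx hrx hxs ?_ ?_)⟩ hh.2
    · exact fun t ht => (hF.lt_iff_of_notMem_level Set.ordConnected_Ico hnoL hrI
        ⟨ht.1.le, ht.2⟩).1 hr
    · exact fun t ht => (hF.lt_iff_of_notMem_level Set.ordConnected_Ioc hnoR hsI
        ⟨ht.1, ht.2.le⟩).1 hs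

lemma mem_incPoints_or_mem_decPoints {h x : ℝ} (hh : h ∈ genericLevels F) (hx : x ∈ level F h) :
    (x, h) ∈ incPoints F ∨ (x, h) ∈ decPoints F := by
  obtain ⟨r, s, hc⟩ := hF.exists_crosses hh hx
  have hU : Set.Icc r s ∈ 𝓝 x := Icc_mem_nhds hc.left hc.right
  have hnoL : ∀ t ∈ Set.Ico r x, t ∉ level F h := fun t ht =>
    hc.notMem t ⟨ht.1, ht.2.le.trans hc.right.le⟩ ht.2.ne
  have hnoR : ∀ t ∈ Set.Ioc x s, t ∉ level F h := fun t ht =>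
    hc.notMem t ⟨hc.left.le.trans ht.1.le, ht.2⟩ ht.1.ne'
  have hrI : r ∈ Set.Ico r x := ⟨le_rfl, hc.left⟩
  have hsI : s ∈ Set.Ioc x s := ⟨hc.right, le_rfl⟩
  refine hc.sign.imp (fun hs => ⟨hx, _, hU, ?_⟩) (fun hs => ⟨hx, _, hU, ?_⟩)
  · rintro ⟨t, k⟩ hk ⟨ht, hne⟩
    rcases lt_or_gt_of_ne (show t ≠ x from hne) with hlt | hlt
    · have ht' : t ∈ Set.Ico r x := ⟨ht.1, hlt⟩
      have := lt_of_mem_uIcc_of_notMem_level' (hnoL t ht')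
        ((hF.gt_iff_of_notMem_level Set.ordConnected_Ico hnoL hrI ht').1 hs.1) hk
      exact mul_pos_of_neg_of_neg (sub_neg.2 this) (sub_neg.2 hlt)
    · have ht' : t ∈ Set.Ioc x s := ⟨hlt, ht.2⟩
      have := lt_of_mem_uIcc_of_notMem_level (hnoR t ht')
        ((hF.lt_iff_of_notMem_level Set.ordConnected_Ioc hnoR hsI ht').1 hs.2) hk
      exact mul_pos (sub_pos.2 this) (sub_pos.2 hlt)
  · rintro ⟨t, k⟩ hk ⟨ht, hne⟩
    rcases lt_or_gt_of_ne (show t ≠ x from hne) with hlt | hlt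
    · have ht' : t ∈ Set.Ico r x := ⟨ht.1, hlt⟩
      have := lt_of_mem_uIcc_of_notMem_level (hnoL t ht')
        ((hF.lt_iff_of_notMem_level Set.ordConnected_Ico hnoL hrI ht').1 hs.1) hk
      exact mul_neg_of_pos_of_neg (sub_pos.2 this) (sub_neg.2 hlt)
    · have ht' : t ∈ Set.Ioc x s := ⟨hlt, ht.2⟩
      have := lt_of_mem_uIcc_of_notMem_level' (hnoR t ht')
        ((hF.gt_iff_of_notMem_level Set.ordConnected_Ioc hnoR hsI ht').1 hs.2) hk
      exact mul_neg_of_neg_of_pos (sub_neg.2 this) (sub_pos.2 hlt)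

/-- At a generic level, the indicatrix counts the generalized solutions. -/
lemma indicatrix_eq {h : ℝ} (hh : h ∈ genericLevels F) :
    indicatrix F h = ((level F h).encard : ℝ≥0∞) := by
  have : level F h = {x | (x, h) ∈ incPoints F} ∪ {x | (x, h) ∈ decPoints F} := by
    ext x
    exact ⟨hF.mem_incPoints_or_mem_decPoints hh, fun hx => hx.elim (fun h => h.1) fun h => h.1⟩
  rw [indicatrix, this, Set.encard_union_eq (disjoint_incPoints_decPoints F h)]

end IsRegulated

/-! ### Routes at a generic positive level -/

/-- The enumeration of the generalized solutions at a level where they are finite in number. -/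
structure Enumerates (F : ℝ → ℝ) (h : ℝ) {N : ℕ} (x : Fin N → ℝ) : Prop where
  strictMono : StrictMono x
  range : Set.range x = level F h

lemma exists_enumerates {F : ℝ → ℝ} {h : ℝ} (hfin : (level F h).Finite) :
    ∃ (N : ℕ) (x : Fin N → ℝ), Enumerates F h x := by
  refine ⟨_, hfin.toFinset.orderEmbOfFin rfl, OrderEmbedding.strictMono _, ?_⟩
  rw [Finset.range_orderEmbOfFin, Set.Finite.coe_toFinset]

namespace Enumerates

variable {F : ℝ → ℝ} {h : ℝ} {N : ℕ} {x : Fin N → ℝ} (hx : Enumerates F h x)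
include hx

lemma encard_level : (level F h).encard = N := by
  rw [← hx.range, ← Set.image_univ, hx.strictMono.injective.encard_image, Set.encard_univ]
  simp

lemma mem (i : Fin N) : x i ∈ level F h := hx.range ▸ Set.mem_range_self i

lemma exists_eq {t : ℝ} (ht : t ∈ level F h) : ∃ i, x i = t := by
  rwa [← hx.range] at ht

lemma mem_routes (h0 : 0 < h) {z : ℝ × ℝ} :
    z ∈ routes F h ↔ ∃ i j : Fin N, Even (i : ℕ) ∧ (j : ℕ) = i + 1 ∧ z = (x i, x j) := by
  constructor
  · rintro ⟨N', y, i, j, hy, hyr, hi, hij, (⟨-, hz⟩ | ⟨hneg, -⟩)⟩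
    · have hy' : Enumerates F h y := ⟨hy, hyr⟩
      obtain rfl : N' = N := by
        have := hy'.encard_level.symm.trans hx.encard_level
        exact_mod_cast this
      obtain rfl : y = x := (StrictMono.range_inj hy hx.strictMono).1 (hyr.trans hx.range.symm)
      exact ⟨i, j, hi, hij, hz⟩
    · exact absurd hneg h0.not_gt
  · rintro ⟨i, j, hi, hij, hz⟩
    exact ⟨N, x, i, j, hx.strictMono, hx.range, hi, hij, Or.inl ⟨h0, hz⟩⟩

variable {κ : Measure ℝ} (hF : IsRegulated F κ) (h0 : 0 < h) (hh : h ∈ genericLevels F)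
include hF h0

/-- `F` tends to `0 < h` at `-∞`, and its position relative to `h` cannot change before the first
solution. -/
lemma lt_of_forall_lt {t : ℝ} (ht : ∀ j, t < x j) : F t < h := by
  have hl : ∀ u ∈ Set.Iic t, u ∉ level F h := fun u hu hul => by
    obtain ⟨j, rfl⟩ := hx.exists_eq hul
    exact absurd (ht j) (not_lt.2 hu)
  obtain ⟨u, hu1, hu2⟩ := ((hF.atBot.eventually (gt_mem_nhds h0)).and
    (eventually_le_atBot t)).exists
  exact (hF.gt_iff_of_notMem_level Set.ordConnected_Iic hl hu2 Set.self_mem_Iic).1 hu1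

include hh

/-- To the right of a solution, the sign of `F - h` is given by the parity of its index. -/
lemma sign_right (n : ℕ) (hn : n < N) (t : ℝ) (ht : x ⟨n, hn⟩ < t)
    (ht' : ∀ j : Fin N, n < j → t < x j) :
    (Even n → h < F t) ∧ (¬ Even n → F t < h) := by
  induction n generalizing t with
  | zero =>
    obtain ⟨r, s, hc⟩ := hF.exists_crosses hh (hx.mem ⟨0, hn⟩)
    have hr : F r < h := hx.lt_of_forall_lt hF h0 fun j =>
      hc.left.trans_le (hx.strictMono.monotone (Fin.mk_le_of_le_val (Nat.zero_le _)))
    have hs : h < F s := (hc.sign.resolve_right fun h => absurd h.1 hr.not_gt).2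
    have hno : ∀ u ∈ Set.Ioc (x ⟨0, hn⟩) (max s t), u ∉ level F h := by
      rintro u ⟨hu1, hu2⟩ hul
      rcases le_max_iff.1 hu2 with hu2 | hu2
      · exact hc.notMem u ⟨hc.left.le.trans hu1.le, hu2⟩ hu1.ne' hul
      · obtain ⟨j, rfl⟩ := hx.exists_eq hul
        exact absurd (ht' j (hx.strictMono.lt_iff_lt.1 hu1)) (not_lt.2 hu2)
    refine ⟨fun _ => ?_, fun h => absurd Even.zero h⟩
    exact (hF.lt_iff_of_notMem_level Set.ordConnected_Ioc hno ⟨hc.right, le_max_left _ _⟩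
      ⟨ht, le_max_right _ _⟩).1 hs
  | succ n ih =>
    have hn' : n < N := by omega
    obtain ⟨r, s, hc⟩ := hF.exists_crosses hh (hx.mem ⟨n + 1, hn⟩)
    have hlt : x ⟨n, hn'⟩ < x ⟨n + 1, hn⟩ := hx.strictMono (by simp)
    have hr : x ⟨n, hn'⟩ < r := by
      by_contra! hle
      exact hc.notMem _ ⟨hle, hlt.le.trans hc.right.le⟩ hlt.ne (hx.mem _)
    have hsr := ih hn' r hr fun j hj => hc.left.trans_le (hx.strictMono.monotone hj)
    have hno : ∀ u ∈ Set.Ioc (x ⟨n + 1, hn⟩) (max s t), u ∉ level F h := by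
      rintro u ⟨hu1, hu2⟩ hul
      rcases le_max_iff.1 hu2 with hu2 | hu2
      · exact hc.notMem u ⟨hc.left.le.trans hu1.le, hu2⟩ hu1.ne' hul
      · obtain ⟨j, rfl⟩ := hx.exists_eq hul
        exact absurd (ht' j (hx.strictMono.lt_iff_lt.1 hu1)) (not_lt.2 hu2)
    have hsI : s ∈ Set.Ioc (x ⟨n + 1, hn⟩) (max s t) := ⟨hc.right, le_max_left _ _⟩
    have htI : t ∈ Set.Ioc (x ⟨n + 1, hn⟩) (max s t) := ⟨ht, le_max_right _ _⟩
    rw [Nat.even_add_one, not_not]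
    refine ⟨fun he => ?_, fun he => ?_⟩
    · have := (hc.sign.resolve_right fun h => absurd h.1 (hsr.2 he).not_gt).2
      exact (hF.lt_iff_of_notMem_level Set.ordConnected_Ioc hno hsI htI).1 this
    · have := (hc.sign.resolve_left fun h => absurd h.1 (hsr.1 he).not_gt).2
      exact (hF.gt_iff_of_notMem_level Set.ordConnected_Ioc hno hsI htI).1 this

/-- After the last solution `F` is below `h`, since it tends to `0` at `+∞`. With indices from `0`,
the last one is therefore odd. -/
lemma even_card : Even N := by
  rcases Nat.eq_zero_or_pos N with rfl | hN
  · exact Even.zero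
  by_contra hodd
  have hn : N - 1 < N := by omega
  obtain ⟨t, htF, ht⟩ := ((hF.atTop.eventually (gt_mem_nhds h0)).and
    (eventually_gt_atTop (x ⟨N - 1, hn⟩))).exists
  have he : Even (N - 1) := by
    obtain ⟨k, hk⟩ := Nat.not_even_iff_odd.1 hodd
    exact ⟨k, by omega⟩
  exact absurd ((hx.sign_right hF h0 hh (N - 1) hn t ht fun j hj => by omega).1 he) htF.not_gt

end Enumerates

namespace Enumerates

variable {F : ℝ → ℝ} {h : ℝ} {N : ℕ} {x : Fin N → ℝ} (hx : Enumerates F h x)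
include hx

/-- The intervals between solutions `2k` and `2k + 1` are pairwise disjoint, so at most one of them
contains `[a, b]`. -/
lemma eq_of_mem_cover (h0 : 0 < h) {a b : ℝ} (hab : a ≤ b) {z w : ℝ × ℝ} (hz : z ∈ routes F h)
    (hw : w ∈ routes F h) (hzc : z ∈ cover a b) (hwc : w ∈ cover a b) : z = w := by
  obtain ⟨i, j, hi, hij, rfl⟩ := (hx.mem_routes h0).1 hz
  obtain ⟨i', j', hi', hij', rfl⟩ := (hx.mem_routes h0).1 hw
  obtain ⟨h1, h2⟩ := mem_cover.1 hzc
  obtain ⟨h3, h4⟩ := mem_cover.1 hwc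
  have e1 := Fin.lt_def.1 (hx.strictMono.lt_iff_lt.1 (h1.trans_lt (hab.trans_lt h4)))
  have e2 := Fin.lt_def.1 (hx.strictMono.lt_iff_lt.1 (h3.trans_lt (hab.trans_lt h2)))
  obtain rfl : i = i' := Fin.ext (by omega)
  obtain rfl : j = j' := Fin.ext (by omega)
  rfl

variable {κ : Measure ℝ} (hF : IsRegulated F κ) (h0 : 0 < h) (hh : h ∈ genericLevels F)
include hF h0 hh

/-- Half of the generalized solutions are starting points of routes. -/
lemma encard_routes_add_self : (routes F h).encard + (routes F h).encard = (level F h).encard := by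
  obtain ⟨m, rfl⟩ := hx.even_card hF h0 hh
  have hr : routes F h =
      Set.range fun k : Fin m => (x ⟨k + k, by omega⟩, x ⟨k + k + 1, by omega⟩) := by
    ext z
    rw [hx.mem_routes h0]
    constructor
    · rintro ⟨i, j, ⟨k, hk⟩, hj, rfl⟩
      refine ⟨⟨k, by omega⟩, ?_⟩
      have e1 : (⟨k + k, by omega⟩ : Fin (m + m)) = i := Fin.ext hk.symm
      have e2 : (⟨k + k + 1, by omega⟩ : Fin (m + m)) = j := Fin.ext (by simp only; omega)
      simp only [e1, e2]
    · rintro ⟨k, rfl⟩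
      exact ⟨_, _, ⟨k, rfl⟩, rfl, rfl⟩
  have hinj : Function.Injective
      fun k : Fin m => (x ⟨k + k, by omega⟩, x ⟨k + k + 1, by omega⟩) := by
    intro k l hkl
    have := congrArg Fin.val (hx.strictMono.injective (Prod.ext_iff.1 hkl).1)
    simp only at this
    exact Fin.ext (by omega)
  rw [hr, ← Set.image_univ, hinj.encard_image, Set.encard_univ, hx.encard_level]
  simp

lemma le_of_mem_cover {a b : ℝ} {z : ℝ × ℝ} (hz : z ∈ routes F h) (hc : z ∈ cover a b) :
    ∀ t ∈ Set.Icc a b, h ≤ F t := by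
  obtain ⟨i, j, hi, hij, rfl⟩ := (hx.mem_routes h0).1 hz
  obtain ⟨ha, hb⟩ := mem_cover.1 hc
  have key : ∀ t, x i < t → t < x j → h < F t := fun t h1 h2 =>
    (hx.sign_right hF h0 hh i i.2 t h1 fun k hk =>
      h2.trans_le (hx.strictMono.monotone (Fin.le_def.2 (by omega)))).1 hi
  intro t ht
  rcases (ha.trans ht.1).eq_or_lt with e | hlt
  · have hlt : t < x j := e ▸ hx.strictMono (Fin.lt_def.2 (by omega))
    refine ge_of_tendsto (hF.right t) ?_
    filter_upwards [Ioo_mem_nhdsGT hlt] with u hu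
    exact (key u (e.trans_lt hu.1) hu.2).le
  · exact (key t hlt (ht.2.trans_lt hb)).le

/-- The margin `h < k` also keeps the left limits above `h`. With `h < F` alone, a left limit could
equal `h` and create a solution in `]a, b]`. -/
lemma exists_mem_cover {a b k : ℝ} (hab : a ≤ b) (hk : h < k) (hle : ∀ t ∈ Set.Icc a b, k ≤ F t) :
    ∃ z ∈ routes F h, z ∈ cover a b := by
  have hno : ∀ t ∈ Set.Ioc a b, t ∉ level F h := by
    intro t ht hl
    have hL : k ≤ Function.leftLim F t := by
      refine ge_of_tendsto (hF.left t) ?_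
      filter_upwards [Ioo_mem_nhdsLT ht.1] with u hu using hle u ⟨hu.1.le, hu.2.le.trans ht.2⟩
    exact absurd ((le_min hL (hle t ⟨ht.1.le, ht.2⟩)).trans (mem_level.1 hl).1) (not_le.2 hk)
  have haF : h < F a := hk.trans_le (hle a ⟨le_rfl, hab⟩)
  have hne : (Finset.univ.filter fun i => x i ≤ a).Nonempty := by
    by_contra hne
    rw [Finset.not_nonempty_iff_eq_empty, Finset.filter_eq_empty_iff] at hne
    exact absurd (hx.lt_of_forall_lt hF h0 fun j => not_le.1 (hne (Finset.mem_univ j))) haF.not_gt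
  -- The last solution up to `a` starts the route. Its index is even as `F` exceeds `h` at `a`, and
  -- it has a successor as the number of solutions is even.
  obtain ⟨i, hi, himax⟩ := Finset.exists_max_image _ id hne
  rw [Finset.mem_filter] at hi
  have hgt : ∀ j : Fin N, i < j → b < x j := by
    intro j hj
    have haj : a < x j := by
      by_contra! hle
      exact absurd (himax j (Finset.mem_filter.2 ⟨Finset.mem_univ _, hle⟩)) (not_le.2 hj)
    by_contra! hle
    exact hno _ ⟨haj, hle⟩ (hx.mem j)
  have hiE : Even (i : ℕ) := by
    by_contra hodd
    have hev : ∀ᶠ t in 𝓝[>] a, ∀ j : Fin N, i < j → t < x j := by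
      refine eventually_all.2 fun j => ?_
      by_cases hj : i < j
      · filter_upwards [Ioo_mem_nhdsGT (hab.trans_lt (hgt j hj))] with t ht _ using ht.2
      · exact Eventually.of_forall fun t hj' => absurd hj' hj
    have hlim : F a ≤ h := by
      refine le_of_tendsto (hF.right a) ?_
      filter_upwards [hev, self_mem_nhdsWithin] with t ht hta
      exact ((hx.sign_right hF h0 hh i i.2 t (hi.2.trans_lt hta) fun j hj =>
        ht j (Fin.lt_def.2 hj)).2 hodd).le
    exact absurd haF (not_lt.2 hlim)
  have hiN : (i : ℕ) + 1 < N := by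
    obtain ⟨m, hm⟩ := hx.even_card hF h0 hh
    obtain ⟨l, hl⟩ := hiE
    have := i.2
    omega
  exact ⟨_, (hx.mem_routes h0).2 ⟨i, ⟨i + 1, hiN⟩, hiE, rfl, rfl⟩, hi.2,
    hgt _ (Fin.lt_def.2 (Nat.lt_succ_self _))⟩

end Enumerates

/-! ### The excursion coupling of two measures in terms of the levels -/

lemma isRegulated_cdfDiff (μ ν : Measure ℝ) [IsProbabilityMeasure μ] [IsProbabilityMeasure ν] :
    IsRegulated (cdfDiff μ ν) (μ + ν) := by
  have e : cdfDiff μ ν = fun t => ProbabilityTheory.cdf μ t - ProbabilityTheory.cdf ν t := by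
    ext t
    rw [cdfDiff, ProbabilityTheory.cdf_eq_real, ProbabilityTheory.cdf_eq_real]
  have hr : ∀ (μ : Measure ℝ) x,
      Tendsto (ProbabilityTheory.cdf μ) (𝓝[>] x) (𝓝 (ProbabilityTheory.cdf μ x)) := fun μ x =>
    ((ProbabilityTheory.cdf μ).right_continuous x).mono_left
      (nhdsWithin_mono _ Set.Ioi_subset_Ici_self)
  refine ⟨fun x => ?_, fun x => ?_, ?_, ?_, fun a b => ?_⟩
  · rw [e]
    exact (hr μ x).sub (hr ν x)
  · have h := ((ProbabilityTheory.monotone_cdf μ).tendsto_leftLim x).sub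
      ((ProbabilityTheory.monotone_cdf ν).tendsto_leftLim x)
    rw [e, leftLim_eq_of_tendsto h]
    exact h
  · rw [e]
    simpa using (ProbabilityTheory.tendsto_cdf_atTop μ).sub (ProbabilityTheory.tendsto_cdf_atTop ν)
  · rw [e]
    simpa using (ProbabilityTheory.tendsto_cdf_atBot μ).sub (ProbabilityTheory.tendsto_cdf_atBot ν)
  · have hinc : ∀ (ρ : Measure ℝ) [IsProbabilityMeasure ρ], ∀ t ∈ Set.Ioc a b,
        ρ.real (Set.Iic t) ∈ Set.Icc (ρ.real (Set.Iic a))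
          (ρ.real (Set.Iic a) + ρ.real (Set.Ioc a b)) := by
      intro ρ _ t ht
      refine ⟨measureReal_mono (Set.Iic_subset_Iic.2 ht.1.le), ?_⟩
      refine le_trans (measureReal_mono ?_) (measureReal_union_le _ _)
      intro u hu
      rcases le_or_gt u a with h | h
      · exact Or.inl h
      · exact Or.inr ⟨h, le_trans hu ht.2⟩
    -- On `]a, b]` the difference rises by at most the `μ`-mass and falls by at most the `ν`-mass of
    -- the interval.
    refine ⟨cdfDiff μ ν a - ν.real (Set.Ioc a b), fun t ht => ?_⟩
    have h1 := hinc μ t ht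
    have h2 := hinc ν t ht
    rw [Set.mem_Icc] at h1 h2 ⊢
    have e2 : ((μ + ν) (Set.Ioc a b)).toReal = μ.real (Set.Ioc a b) + ν.real (Set.Ioc a b) := by
      rw [Measure.add_apply, ENNReal.toReal_add (measure_ne_top _ _) (measure_ne_top _ _)]
      rfl
    rw [e2, cdfDiff, cdfDiff]
    constructor <;> linarith

/-! ### Counting measures on the routes. -/

lemma count_restrict_apply {R : Set (ℝ × ℝ)} (hR : R.Finite) (B : Set (ℝ × ℝ)) :
    Measure.count.restrict R B = ((B ∩ R).encard : ℝ≥0∞) := by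
  rw [Measure.restrict_apply' hR.measurableSet,
    Measure.count_apply (hR.subset Set.inter_subset_right).measurableSet]

lemma routes_subset_rightward {F : ℝ → ℝ} {h : ℝ} (h0 : 0 < h) : routes F h ⊆ rightward := by
  rintro z ⟨N, x, i, j, hx, -, -, hij, (⟨-, rfl⟩ | ⟨hneg, -⟩)⟩
  · exact hx (Fin.lt_def.2 (by omega))
  · exact absurd hneg h0.not_gt

/-- The counting measure on the routes at a generic positive level. -/
noncomputable def routeMeasure (F : ℝ → ℝ) : ℝ → Measure (ℝ × ℝ) :=
  (genericLevels F ∩ Set.Ioi 0).indicator fun h => Measure.count.restrict (routes F h)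

namespace IsRegulated

variable {F : ℝ → ℝ} {κ : Measure ℝ} (hF : IsRegulated F κ)
include hF

lemma encard_routes_add_self {h : ℝ} (hh : h ∈ genericLevels F) (h0 : 0 < h) :
    (routes F h).encard + (routes F h).encard = (level F h).encard := by
  obtain ⟨N, x, hx⟩ := exists_enumerates hh.1
  exact hx.encard_routes_add_self hF h0 hh

lemma finite_routes {h : ℝ} (hh : h ∈ genericLevels F) (h0 : 0 < h) : (routes F h).Finite := by
  rw [← Set.encard_lt_top_iff]
  refine lt_of_le_of_lt ?_ (Set.encard_lt_top_iff.2 hh.1)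
  rw [← hF.encard_routes_add_self hh h0]
  exact le_self_add

lemma routeMeasure_apply {h : ℝ} (hh : h ∈ genericLevels F) (h0 : 0 < h) (B : Set (ℝ × ℝ)) :
    routeMeasure F h B = ((B ∩ routes F h).encard : ℝ≥0∞) := by
  rw [routeMeasure,
    Set.indicator_of_mem (show h ∈ genericLevels F ∩ Set.Ioi 0 from ⟨hh, h0⟩),
    count_restrict_apply (hF.finite_routes hh h0)]

lemma isFiniteMeasure_routeMeasure (h : ℝ) : IsFiniteMeasure (routeMeasure F h) := by
  by_cases hh : h ∈ genericLevels F ∩ Set.Ioi 0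
  · refine ⟨?_⟩
    rw [hF.routeMeasure_apply hh.1 hh.2, Set.univ_inter, ← ENat.toENNReal_top, ENat.toENNReal_lt]
    exact Set.encard_lt_top_iff.2 (hF.finite_routes hh.1 hh.2)
  · rw [routeMeasure, Set.indicator_of_notMem hh]
    infer_instance

lemma routeMeasure_rightward_compl (h : ℝ) : routeMeasure F h rightwardᶜ = 0 := by
  by_cases hh : h ∈ genericLevels F ∩ Set.Ioi 0
  · rw [hF.routeMeasure_apply hh.1 hh.2, Set.disjoint_iff_inter_eq_empty.1]
    · simp
    · exact Set.disjoint_compl_left_iff_subset.2 (routes_subset_rightward hh.2)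
  · rw [routeMeasure, Set.indicator_of_notMem hh]
    simp

/-- A generic level below the infimum of `F` over `[a, b]` has exactly one route that covers
`[a, b]`, and the levels above the infimum have none. -/
lemma routeMeasure_cover {a b h : ℝ} (hab : a ≤ b) (hh : h ∈ genericLevels F)
    (hne : h ≠ (⨅ t ∈ Set.Icc a b, ENNReal.ofReal (F t)).toReal) :
    routeMeasure F h (cover a b) =
      (Set.Ioo 0 (⨅ t ∈ Set.Icc a b, ENNReal.ofReal (F t)).toReal).indicator 1 h := by
  set m := ⨅ t ∈ Set.Icc a b, ENNReal.ofReal (F t) with hm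
  have hmt : m ≠ ∞ := ne_top_of_le_ne_top ENNReal.ofReal_ne_top (iInf₂_le a ⟨le_rfl, hab⟩)
  rcases le_or_gt h 0 with h0 | h0
  · rw [routeMeasure, Set.indicator_of_notMem fun h' => absurd h'.2 (not_lt.2 h0),
      Set.indicator_of_notMem fun h' : h ∈ Set.Ioo 0 m.toReal => absurd h'.1 (not_lt.2 h0)]
    rfl
  obtain ⟨N, x, hx⟩ := exists_enumerates hh.1
  rw [hF.routeMeasure_apply hh h0]
  rcases lt_or_gt_of_ne hne with hlt | hlt
  · have hle : ∀ t ∈ Set.Icc a b, m.toReal ≤ F t := by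
      intro t ht
      have : ENNReal.ofReal m.toReal ≤ ENNReal.ofReal (F t) := by
        rw [ENNReal.ofReal_toReal hmt]; exact iInf₂_le t ht
      rcases ENNReal.ofReal_le_ofReal_iff'.1 this with h1 | h1
      · exact h1
      · exact absurd h1 (not_le.2 (h0.trans hlt))
    obtain ⟨z, hz, hzc⟩ := hx.exists_mem_cover hF h0 hh hab hlt hle
    have : cover a b ∩ routes F h = {z} :=
      Set.eq_singleton_iff_unique_mem.2 ⟨⟨hzc, hz⟩, fun w hw =>
        hx.eq_of_mem_cover h0 hab hw.2 hz hw.1 hzc⟩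
    rw [this, Set.encard_singleton,
      Set.indicator_of_mem (show h ∈ Set.Ioo 0 m.toReal from ⟨h0, hlt⟩)]
    simp
  · have : cover a b ∩ routes F h = ∅ := by
      rw [Set.eq_empty_iff_forall_notMem]
      rintro z ⟨hzc, hz⟩
      have hle : ENNReal.ofReal h ≤ m := le_iInf₂ fun t ht =>
        ENNReal.ofReal_le_ofReal (hx.le_of_mem_cover hF h0 hh hz hzc t ht)
      exact absurd ((ENNReal.ofReal_le_iff_le_toReal hmt).1 hle) (not_le.2 hlt)
    rw [this, Set.indicator_of_notMem fun h' : h ∈ Set.Ioo 0 m.toReal => absurd h'.2 hlt.not_gt]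
    simp

/-- On `covers` the mass is an explicit indicator function, except possibly at the single level `r`,
where measurability is not affected. -/
lemma measurable_routeMeasure : Measurable (routeMeasure F) := by
  have := hF.isFiniteMeasure_routeMeasure
  refine measurable_of_measurable_cover hF.routeMeasure_rightward_compl fun a b hab => ?_
  set r := (⨅ t ∈ Set.Icc a b, ENNReal.ofReal (F t)).toReal with hr
  have hg : Measurable ((genericLevels F).indicator
      ((Set.Ioo 0 r).indicator (1 : ℝ → ℝ≥0∞))) :=
    (measurable_one.indicator measurableSet_Ioo).indicator hF.measurableSet_genericLevels
  refine hg.measurable_of_countable_ne (Set.Countable.mono ?_ (Set.countable_singleton r))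
  intro h hne
  by_contra hhr
  refine hne ?_
  by_cases hh : h ∈ genericLevels F
  · rw [Set.indicator_of_mem hh, hF.routeMeasure_cover hab hh hhr]
  · rw [Set.indicator_of_notMem hh, routeMeasure, Set.indicator_of_notMem fun h' => hh h'.1]
    simp

/-- A layer-cake formula: the levels with a covering route fill, up to a null set, the interval from
`0` to the infimum. -/
lemma lintegral_routeMeasure_cover [IsFiniteMeasure κ] {a b : ℝ} (hab : a ≤ b) :
    ∫⁻ h, routeMeasure F h (cover a b) = ⨅ t ∈ Set.Icc a b, ENNReal.ofReal (F t) := by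
  set m := ⨅ t ∈ Set.Icc a b, ENNReal.ofReal (F t) with hm
  have hmt : m ≠ ∞ := ne_top_of_le_ne_top ENNReal.ofReal_ne_top (iInf₂_le a ⟨le_rfl, hab⟩)
  have : (fun h => routeMeasure F h (cover a b)) =ᵐ[volume]
      (Set.Ioo 0 m.toReal).indicator (1 : ℝ → ℝ≥0∞) := by
    filter_upwards [hF.ae_mem_genericLevels, (Set.countable_singleton m.toReal).ae_notMem volume]
      with h hh hne using hF.routeMeasure_cover hab hh hne
  rw [lintegral_congr_ae this, lintegral_indicator_one measurableSet_Ioo, Real.volume_Ioo, sub_zero,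
    ENNReal.ofReal_toReal hmt]

/-- The routes at a negative level are reversed routes of `-F` at a positive level. -/
lemma swap_mem_routes_neg {h : ℝ} (h0 : h < 0) {z : ℝ × ℝ} :
    z.swap ∈ routes (fun t => -F t) (-h) ↔ z ∈ routes F h := by
  have hl : {t : ℝ | (t, -h) ∈ genGraph fun t => -F t} = {t : ℝ | (t, h) ∈ genGraph F} :=
    hF.level_neg h
  simp only [routes, Set.mem_ofPred_eq]
  rw [hl]
  refine exists_congr fun N => exists_congr fun x => exists_congr fun i => exists_congr fun j =>
    and_congr_right fun _ => and_congr_right fun _ => and_congr_right fun _ =>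
      and_congr_right fun _ => ?_
  constructor
  · rintro (⟨-, hz⟩ | ⟨hh, -⟩)
    · exact Or.inr ⟨h0, Prod.swap_injective hz⟩
    · exact absurd hh (by linarith)
  · rintro (⟨hh, -⟩ | ⟨-, hz⟩)
    · exact absurd hh h0.not_gt
    · exact Or.inl ⟨neg_pos.2 h0, by rw [hz]; rfl⟩

end IsRegulated

/-- The counting measure on the routes at a generic level. -/
noncomputable def routeKernel (F : ℝ → ℝ) (h : ℝ) : Measure (ℝ × ℝ) :=
  routeMeasure F h + (routeMeasure (fun t => -F t) (-h)).map Prod.swap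

namespace IsRegulated

variable {F : ℝ → ℝ} {κ : Measure ℝ} (hF : IsRegulated F κ)
include hF

lemma measurable_routeKernel : Measurable (routeKernel F) := by
  refine Measure.measurable_of_measurable_coe _ fun B hB => ?_
  exact ((Measure.measurable_coe hB).comp hF.measurable_routeMeasure).add
    ((Measure.measurable_coe hB).comp ((Measure.measurable_map _ measurable_swap).comp
      (hF.neg.measurable_routeMeasure.comp measurable_neg)))

lemma isFiniteMeasure_routeKernel (h : ℝ) : IsFiniteMeasure (routeKernel F h) := by
  have h1 := hF.isFiniteMeasure_routeMeasure h
  have h2 := hF.neg.isFiniteMeasure_routeMeasure (-h)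
  have h3 := Measure.isFiniteMeasure_map (routeMeasure (fun t => -F t) (-h)) Prod.swap
  rw [routeKernel]
  infer_instance

/-- Reflection preserves Lebesgue measure, so genericity of `-h` for `-F` holds almost everywhere
without comparison with genericity of `h` for `F`. -/
lemma ae_generic [IsFiniteMeasure κ] :
    ∀ᵐ h, h ≠ 0 ∧ h ∈ genericLevels F ∧ -h ∈ genericLevels fun t => -F t := by
  have h1 : ∀ᵐ h : ℝ, -h ∈ genericLevels fun t => -F t :=
    (Measure.measurePreserving_neg volume).quasiMeasurePreserving.ae hF.neg.ae_mem_genericLevels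
  filter_upwards [(Set.countable_singleton (0 : ℝ)).ae_notMem volume, hF.ae_mem_genericLevels, h1]
    with h h0 h1 h2 using ⟨h0, h1, h2⟩

lemma finite_routes' {h : ℝ} (h0 : h ≠ 0) (hh : h ∈ genericLevels F)
    (hh' : -h ∈ genericLevels fun t => -F t) : (routes F h).Finite := by
  rcases lt_or_gt_of_ne h0 with h0 | h0
  · have := hF.neg.finite_routes hh' (neg_pos.2 h0)
    refine Set.Finite.subset (this.preimage Prod.swap_injective.injOn) fun z hz => ?_
    exact (hF.swap_mem_routes_neg h0).2 hz
  · exact hF.finite_routes hh h0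

lemma routeKernel_eq {h : ℝ} (h0 : h ≠ 0) (hh : h ∈ genericLevels F)
    (hh' : -h ∈ genericLevels fun t => -F t) :
    routeKernel F h = Measure.count.restrict (routes F h) := by
  ext B hB
  rw [count_restrict_apply (hF.finite_routes' h0 hh hh'), routeKernel, Measure.add_apply,
    Measure.map_apply measurable_swap hB]
  rcases lt_or_gt_of_ne h0 with h0 | h0
  · rw [hF.neg.routeMeasure_apply hh' (neg_pos.2 h0), routeMeasure,
      Set.indicator_of_notMem fun h' => absurd h'.2 (not_lt.2 h0.le), Measure.coe_zero,
      Pi.zero_apply, zero_add, ← (Prod.swap_injective (α := ℝ) (β := ℝ)).encard_image]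
    congr 2
    ext z
    rw [Set.image_swap_eq_preimage_swap, Set.mem_preimage, Set.mem_inter_iff, Set.mem_inter_iff,
      hF.swap_mem_routes_neg h0, Set.mem_preimage, Prod.swap_swap]
  · rw [hF.routeMeasure_apply hh h0, routeMeasure,
      Set.indicator_of_notMem fun h' => absurd h'.2 (not_lt.2 (neg_nonpos.2 h0.le)),
      Measure.coe_zero, Pi.zero_apply, add_zero]

lemma routeKernel_univ_add_self {h : ℝ} (h0 : h ≠ 0) (hh : h ∈ genericLevels F)
    (hh' : -h ∈ genericLevels fun t => -F t) :
    routeKernel F h Set.univ + routeKernel F h Set.univ = indicatrix F h := by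
  rw [hF.routeKernel_eq h0 hh hh', count_restrict_apply (hF.finite_routes' h0 hh hh'),
    Set.univ_inter, hF.indicatrix_eq hh, ← ENat.toENNReal_add]
  congr 1
  rcases lt_or_gt_of_ne h0 with h0 | h0
  · rw [← hF.level_neg, ← hF.neg.encard_routes_add_self hh' (neg_pos.2 h0)]
    have : routes F h = Prod.swap '' routes (fun t => -F t) (-h) := by
      ext z
      rw [Set.image_swap_eq_preimage_swap, Set.mem_preimage, hF.swap_mem_routes_neg h0]
    rw [this, Prod.swap_injective.encard_image]
  · exact hF.encard_routes_add_self hh h0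

/-- Averaging over the levels, every route has the same weight. -/
lemma bind_levelLaw_apply [IsFiniteMeasure κ] {B : Set (ℝ × ℝ)} (hB : MeasurableSet B) :
    (levelLaw F).bind (fun h => ProbabilityTheory.uniformOn (routes F h)) B
      = ∫⁻ h, routeKernel F h B := by
  have hfin := hF.isFiniteMeasure_routeKernel
  have hmk : ∀ C, MeasurableSet C → Measurable fun h => routeKernel F h C := fun C hC =>
    (Measure.measurable_coe hC).comp hF.measurable_routeKernel
  -- The uniform laws agree with a measurable kernel only for almost every level. This suffices, as
  -- `levelLaw F` is absolutely continuous.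
  have hK : (fun h => ProbabilityTheory.uniformOn (routes F h)) =ᵐ[volume]
      fun h => (routeKernel F h Set.univ)⁻¹ • routeKernel F h := by
    filter_upwards [hF.ae_generic] with h hh
    rw [hF.routeKernel_eq hh.1 hh.2.1 hh.2.2, Measure.restrict_apply_univ]
    rfl
  have hKm : Measurable fun h => (routeKernel F h Set.univ)⁻¹ • routeKernel F h := by
    refine Measure.measurable_of_measurable_coe _ fun C hC => ?_
    simp only [Measure.smul_apply, smul_eq_mul]
    exact (hmk _ MeasurableSet.univ).inv.mul (hmk C hC)
  have hac : levelLaw F ≪ volume :=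
    (withDensity_absolutelyContinuous _ _).smul_left _
  have hi : AEMeasurable (indicatrix F) volume := by
    refine ⟨_, hF.measurable_encard_level, ?_⟩
    filter_upwards [hF.ae_mem_genericLevels] with h hh using hF.indicatrix_eq hh
  rw [Measure.bind_apply hB ⟨_, hKm, hac.ae_eq hK⟩]
  have hKB : (fun h => ProbabilityTheory.uniformOn (routes F h) B) =ᵐ[volume]
      fun h => (routeKernel F h Set.univ)⁻¹ * routeKernel F h B := by
    filter_upwards [hK] with h hh
    rw [hh, Measure.smul_apply, smul_eq_mul]
  have hKBm : Measurable fun h => (routeKernel F h Set.univ)⁻¹ * routeKernel F h B :=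
    (hmk _ MeasurableSet.univ).inv.mul (hmk B hB)
  rw [lintegral_congr_ae (hac.ae_eq hKB), levelLaw, lintegral_smul_measure,
    lintegral_withDensity_eq_lintegral_mul₀ hi hKBm.aemeasurable, smul_eq_mul,
    ← lintegral_const_mul'' _ (hi.mul hKBm.aemeasurable)]
  refine lintegral_congr_ae ?_
  filter_upwards [hF.ae_generic] with h hh
  have hfh := hfin h
  simp only [Pi.mul_apply]
  -- With `n` routes at a level, the density `i^± / 2` is `n` and the uniform law gives each route
  -- the weight `1 / n`. Levels without routes are treated apart.
  rw [← hF.routeKernel_univ_add_self hh.1 hh.2.1 hh.2.2, ← two_mul, ← mul_assoc, ← mul_assoc,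
    ← mul_assoc (2⁻¹ : ℝ≥0∞) 2, ENNReal.inv_mul_cancel two_ne_zero ENNReal.ofNat_ne_top, one_mul]
  by_cases hz : routeKernel F h Set.univ = 0
  · rw [hz, zero_mul, zero_mul, measure_mono_null (Set.subset_univ B) hz]
  · rw [ENNReal.mul_inv_cancel hz (measure_ne_top _ _), one_mul]

end IsRegulated

/-! ### Identification of the excursion coupling -/

lemma preimage_swap_cover_subset {a b : ℝ} (hab : a ≤ b) :
    Prod.swap ⁻¹' cover a b ⊆ rightwardᶜ := fun _ hz hz' =>
  absurd (mem_rightward.1 (cover_subset_rightward hab hz)) (not_lt.2 (le_of_lt hz'))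

namespace IsRegulated

variable {F : ℝ → ℝ} {κ : Measure ℝ} (hF : IsRegulated F κ)
include hF

lemma routeKernel_cover {a b : ℝ} (hab : a ≤ b) (h : ℝ) :
    routeKernel F h (cover a b) = routeMeasure F h (cover a b) := by
  rw [routeKernel, Measure.add_apply, Measure.map_apply measurable_swap (measurableSet_cover a b),
    measure_mono_null (preimage_swap_cover_subset hab) (hF.neg.routeMeasure_rightward_compl _),
    add_zero]

lemma routeKernel_preimage_swap_cover {a b : ℝ} (hab : a ≤ b) (h : ℝ) :
    routeKernel F h (Prod.swap ⁻¹' cover a b) = routeMeasure (fun t => -F t) (-h) (cover a b) := by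
  rw [routeKernel, Measure.add_apply,
    Measure.map_apply measurable_swap (measurable_swap (measurableSet_cover a b)),
    measure_mono_null (preimage_swap_cover_subset hab) (hF.routeMeasure_rightward_compl _),
    zero_add, ← Set.preimage_comp, Prod.swap_swap_eq, Set.preimage_id]

lemma routeKernel_diagonal (h : ℝ) : routeKernel F h (Set.diagonal ℝ) = 0 := by
  have hd : Set.diagonal ℝ ⊆ rightwardᶜ := fun z hz hz' => absurd hz (ne_of_lt hz')
  have hd' : Prod.swap ⁻¹' Set.diagonal ℝ ⊆ rightwardᶜ := fun z hz hz' =>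
    absurd hz (ne_of_gt hz')
  rw [routeKernel, Measure.add_apply,
    Measure.map_apply measurable_swap isClosed_diagonal.measurableSet,
    measure_mono_null hd (hF.routeMeasure_rightward_compl _),
    measure_mono_null hd' (hF.neg.routeMeasure_rightward_compl _), add_zero]

lemma lintegral_routeKernel_univ_ne_top [IsFiniteMeasure κ] :
    ∫⁻ h, routeKernel F h Set.univ ≠ ∞ := by
  refine ne_top_of_le_ne_top (measure_ne_top κ Set.univ)
    (le_trans (lintegral_mono_ae ?_) hF.lintegral_encard_level_le)
  filter_upwards [hF.ae_generic] with h hh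
  rw [← hF.indicatrix_eq hh.2.1, ← hF.routeKernel_univ_add_self hh.1 hh.2.1 hh.2.2]
  exact le_self_add

end IsRegulated

/-! ### Masses of the excursion coupling on covering routes. -/

section singular

variable (μ ν : Measure ℝ) [IsProbabilityMeasure μ] [IsProbabilityMeasure ν]

instance isFiniteMeasure_singularCoupling : IsFiniteMeasure (singularCoupling μ ν) := by
  have hF := isRegulated_cdfDiff μ ν
  refine ⟨lt_top_iff_ne_top.2 ?_⟩
  rw [singularCoupling, hF.bind_levelLaw_apply MeasurableSet.univ]
  exact hF.lintegral_routeKernel_univ_ne_top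

lemma singularCoupling_diagonal : singularCoupling μ ν (Set.diagonal ℝ) = 0 := by
  have hF := isRegulated_cdfDiff μ ν
  rw [singularCoupling, hF.bind_levelLaw_apply isClosed_diagonal.measurableSet]
  simp [hF.routeKernel_diagonal]

lemma singularCoupling_cover {a b : ℝ} (hab : a ≤ b) :
    singularCoupling μ ν (cover a b) = ⨅ t ∈ Set.Icc a b, ENNReal.ofReal (cdfDiff μ ν t) := by
  have hF := isRegulated_cdfDiff μ ν
  rw [singularCoupling, hF.bind_levelLaw_apply (measurableSet_cover a b)]
  simp_rw [hF.routeKernel_cover hab]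
  exact hF.lintegral_routeMeasure_cover hab

lemma singularCoupling_preimage_swap_cover {a b : ℝ} (hab : a ≤ b) :
    singularCoupling μ ν (Prod.swap ⁻¹' cover a b) =
      ⨅ t ∈ Set.Icc a b, ENNReal.ofReal (cdfDiff ν μ t) := by
  have hF := isRegulated_cdfDiff μ ν
  rw [singularCoupling, hF.bind_levelLaw_apply (measurable_swap (measurableSet_cover a b))]
  simp_rw [hF.routeKernel_preimage_swap_cover hab, cdfDiff_swap μ ν]
  rw [← hF.neg.lintegral_routeMeasure_cover hab]
  exact (Measure.measurePreserving_neg volume).lintegral_comp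
    (f := fun h => routeMeasure (fun t => -cdfDiff μ ν t) h (cover a b))
    ((Measure.measurable_coe (measurableSet_cover a b)).comp hF.neg.measurable_routeMeasure)

end singular

lemma cdfDiff_smul {c : ℝ≥0∞} (μ ν : Measure ℝ) (t : ℝ) :
    cdfDiff (c • μ) (c • ν) t = c.toReal * cdfDiff μ ν t := by
  simp only [cdfDiff, measureReal_ennreal_smul_apply]
  ring

lemma cdfDiff_add_left {η μ ν : Measure ℝ} [IsFiniteMeasure η] [IsFiniteMeasure μ]
    [IsFiniteMeasure ν] (t : ℝ) : cdfDiff (η + μ) (η + ν) t = cdfDiff μ ν t := by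
  have h : ∀ (ρ : Measure ℝ) [IsFiniteMeasure ρ],
      (η + ρ).real (Set.Iic t) = η.real (Set.Iic t) + ρ.real (Set.Iic t) := fun ρ _ =>
    ENNReal.toReal_add (measure_ne_top _ _) (measure_ne_top _ _)
  rw [cdfDiff, cdfDiff, h, h, add_sub_add_left_eq_sub]

lemma mul_iInf_ofReal {c : ℝ≥0∞} (h0 : c ≠ 0) (ht : c ≠ ∞) (s : Set ℝ) (f : ℝ → ℝ) :
    c * ⨅ t ∈ s, ENNReal.ofReal (c⁻¹.toReal * f t) = ⨅ t ∈ s, ENNReal.ofReal (f t) := by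
  rw [ENNReal.mul_iInf_of_ne h0 ht]
  refine iInf_congr fun t => ?_
  rw [ENNReal.mul_iInf_of_ne h0 ht]
  refine iInf_congr fun _ => ?_
  rw [ENNReal.ofReal_mul ENNReal.toReal_nonneg, ENNReal.ofReal_toReal (ENNReal.inv_ne_top.2 h0),
    ← mul_assoc, ENNReal.mul_inv_cancel h0 ht, one_mul]

/-- Mass that two measures have in common at a point belongs to their infimum. -/
lemma eq_zero_or_eq_zero_of_inf_add {η μ ν : Measure ℝ} [IsFiniteMeasure η]
    (h : (η + μ) ⊓ (η + ν) = η) (c : ℝ) : μ {c} = 0 ∨ ν {c} = 0 := by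
  set ε := min (μ {c}) (ν {c}) with hε
  have key : ∀ ρ : Measure ℝ, ε ≤ ρ {c} → η + ε • Measure.dirac c ≤ η + ρ := by
    intro ρ hρ
    refine add_le_add le_rfl (Measure.le_iff.2 fun s hs => ?_)
    rw [Measure.smul_apply, Measure.dirac_apply' _ hs, smul_eq_mul]
    by_cases hc : c ∈ s
    · rw [Set.indicator_of_mem hc, Pi.one_apply, mul_one]
      exact hρ.trans (measure_mono (Set.singleton_subset_iff.2 hc))
    · rw [Set.indicator_of_notMem hc, mul_zero]
      exact zero_le
  have hle : η + ε • Measure.dirac c ≤ η :=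
    (le_inf (key μ (min_le_left _ _)) (key ν (min_le_right _ _))).trans_eq h
  have h1 : η {c} + ε ≤ η {c} + 0 := by
    have := hle {c}
    simpa using this
  have h2 : ε = 0 := le_zero_iff.1 ((ENNReal.add_le_add_iff_left (measure_ne_top η _)).1 h1)
  rcases min_choice (μ {c}) (ν {c}) with e | e
  · exact Or.inl (by rw [← e, ← hε, h2])
  · exact Or.inr (by rw [← e, ← hε, h2])

/-- A plan that leaves the common mass in place, in which routes in the same direction do not
cross and routes in opposite directions do not overlap, is the excursion coupling. -/
theorem eq_excursionCoupling {μ ν : Measure ℝ} [IsProbabilityMeasure μ] [IsProbabilityMeasure ν]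
    {γ : Measure (ℝ × ℝ)} (h1 : γ.map Prod.fst = μ) (h2 : γ.map Prod.snd = ν)
    {Γ : Set (ℝ × ℝ)} (hΓm : MeasurableSet Γ) (hΓ : γ Γᶜ = 0)
    (hcr : ∀ z ∈ Γ, ∀ w ∈ Γ, ¬ (z.1 < w.1 ∧ w.1 < z.2 ∧ z.2 < w.2))
    (hcl : ∀ z ∈ Γ, ∀ w ∈ Γ, ¬ (z.2 < w.2 ∧ w.2 < z.1 ∧ z.1 < w.1))
    (hop : ∀ z ∈ Γ, ∀ w ∈ Γ, ∀ t, z ∈ cover t t → w.swap ∉ cover t t)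
    (hinf : μ ⊓ ν = (γ.restrict (Set.diagonal ℝ)).map Prod.fst) :
    γ = excursionCoupling μ ν := by
  have hγ : IsFiniteMeasure γ := ⟨by
    rw [← Set.preimage_univ (f := Prod.fst), ← Measure.map_apply measurable_fst MeasurableSet.univ,
      h1]
    exact measure_lt_top μ _⟩
  have hdm : MeasurableSet (Set.diagonal ℝ) := isClosed_diagonal.measurableSet
  set η := μ ⊓ ν with hη
  set γ' := γ.restrict (Set.diagonal ℝ)ᶜ with hγ'
  set μ' := γ'.map Prod.fst with hμ'
  set ν' := γ'.map Prod.snd with hν'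
  have e1 : μ = η + μ' := by rw [hinf]; exact map_fst_split h1
  have e2 : ν = η + ν' := by rw [hinf]; exact map_snd_split h2
  have hηf : IsFiniteMeasure η := by rw [hinf]; infer_instance
  have hμ'f : IsFiniteMeasure μ' := by rw [hμ']; infer_instance
  have hν'f : IsFiniteMeasure ν' := by rw [hν']; infer_instance
  have e3 : μ - η = μ' := by
    conv_lhs => rw [e1, add_comm]
    exact Measure.add_sub_cancel
  have e4 : ν - η = ν' := by
    conv_lhs => rw [e2, add_comm]
    exact Measure.add_sub_cancel
  have hdiag : γ.restrict (Set.diagonal ℝ) = η.map fun x => (x, x) := by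
    rw [hinf, Measure.map_map (by fun_prop) measurable_fst]
    conv_lhs => rw [← Measure.map_id (μ := γ.restrict (Set.diagonal ℝ))]
    refine Measure.map_congr ?_
    filter_upwards [ae_restrict_mem hdm] with z hz
    exact Prod.ext rfl hz.symm
  have hm1 : μ' Set.univ = γ' Set.univ := by
    rw [hμ', Measure.map_apply measurable_fst MeasurableSet.univ, Set.preimage_univ]
  have hm2 : ν' Set.univ = γ' Set.univ := by
    rw [hν', Measure.map_apply measurable_snd MeasurableSet.univ, Set.preimage_univ]
  rw [excursionCoupling, ← hη, e3, e4, hm1, hm2, ← hdiag]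
  conv_lhs => rw [← Measure.restrict_add_restrict_compl (μ := γ) hdm, ← hγ']
  congr 1
  set m := γ' Set.univ with hm
  have hmt : m ≠ ∞ := measure_ne_top _ _
  by_cases hm0 : m = 0
  · rw [hm0, zero_smul]
    exact Measure.measure_univ_eq_zero.1 hm0
  have hp1 : IsProbabilityMeasure (m⁻¹ • μ') := ⟨by
    rw [Measure.smul_apply, hm1, smul_eq_mul, ENNReal.inv_mul_cancel hm0 hmt]⟩
  have hp2 : IsProbabilityMeasure (m⁻¹ • ν') := ⟨by
    rw [Measure.smul_apply, hm2, smul_eq_mul, ENNReal.inv_mul_cancel hm0 hmt]⟩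
  -- Removing the common mass does not change the difference of the distribution functions.
  have hcdf : ∀ t, cdfDiff μ' ν' t = cdfDiff μ ν t := fun t => by
    rw [e1, e2, cdfDiff_add_left]
  -- A point where moving mass both starts and ends would carry an atom common to `μ'` and `ν'`,
  -- which belongs to `η`.
  have hatom : ∀ c, γ {z | z.1 = c ∧ z.2 ≠ c} = 0 ∨ γ {z | z.1 ≠ c ∧ z.2 = c} = 0 := by
    intro c
    refine (eq_zero_or_eq_zero_of_inf_add (η := η) (μ := μ') (ν := ν')
      (by rw [← e1, ← e2]) c).imp (fun h => ?_) (fun h => ?_)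
    · rw [hμ', Measure.map_apply measurable_fst (measurableSet_singleton c), hγ',
        Measure.restrict_apply (measurable_fst (measurableSet_singleton c))] at h
      refine measure_mono_null ?_ h
      rintro z ⟨hz1, hz2⟩
      exact ⟨hz1, fun hz => hz2 (Eq.trans (Eq.symm hz) hz1)⟩
    · rw [hν', Measure.map_apply measurable_snd (measurableSet_singleton c), hγ',
        Measure.restrict_apply (measurable_snd (measurableSet_singleton c))] at h
      refine measure_mono_null ?_ h
      rintro z ⟨hz1, hz2⟩
      exact ⟨hz2, fun hz => hz1 (Eq.trans hz hz2)⟩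
  have hcov : ∀ a b, a ≤ b →
      γ (cover a b) = ⨅ t ∈ Set.Icc a b, ENNReal.ofReal (cdfDiff μ ν t) := by
    intro a b hab
    rw [measure_cover_eq_iInf hΓ hcr hatom hab]
    exact iInf_congr fun t => iInf_congr fun _ => measure_cover_self h1 h2 hΓ hop t
  have hcov' : ∀ a b, a ≤ b →
      γ (Prod.swap ⁻¹' cover a b) = ⨅ t ∈ Set.Icc a b, ENNReal.ofReal (cdfDiff ν μ t) := by
    intro a b hab
    have hsf := Measure.isFiniteMeasure_map γ Prod.swap
    have hΓ' : γ.map Prod.swap (Prod.swap ⁻¹' Γ)ᶜ = 0 := by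
      rw [Measure.map_apply measurable_swap (measurable_swap hΓm).compl, Set.preimage_compl,
        ← Set.preimage_comp, Prod.swap_swap_eq, Set.preimage_id, hΓ]
    have hatom' : ∀ c, γ.map Prod.swap {z | z.1 = c ∧ z.2 ≠ c} = 0 ∨
        γ.map Prod.swap {z | z.1 ≠ c ∧ z.2 = c} = 0 := by
      intro c
      have hc1 : MeasurableSet {z : ℝ × ℝ | z.1 = c ∧ z.2 ≠ c} :=
        (measurable_fst (measurableSet_singleton c)).inter
          (measurable_snd (measurableSet_singleton c)).compl
      have hc2 : MeasurableSet {z : ℝ × ℝ | z.1 ≠ c ∧ z.2 = c} :=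
        (measurable_fst (measurableSet_singleton c)).compl.inter
          (measurable_snd (measurableSet_singleton c))
      rw [Measure.map_apply measurable_swap hc1, Measure.map_apply measurable_swap hc2]
      refine (hatom c).symm.imp (fun h => ?_) (fun h => ?_)
      · exact measure_mono_null (fun z hz => And.symm hz) h
      · exact measure_mono_null (fun z hz => And.symm hz) h
    rw [← Measure.map_apply measurable_swap (measurableSet_cover a b),
      measure_cover_eq_iInf hΓ' (fun z hz w hw => hcl _ hz _ hw) hatom' hab]
    refine iInf_congr fun t => iInf_congr fun _ => measure_cover_self (μ := ν) (ν := μ) ?_ ?_ hΓ'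
      (fun z hz w hw t hzt hwt => hop w.swap hw z.swap hz t hwt hzt) t
    · rw [Measure.map_map measurable_fst measurable_swap]
      exact h2
    · rw [Measure.map_map measurable_snd measurable_swap]
      exact h1
  have hγd : γ' (Set.diagonal ℝ) = 0 := by
    rw [hγ', Measure.restrict_apply hdm, Set.inter_compl_self, measure_empty]
  have hsub : ∀ {a b : ℝ}, a ≤ b → cover a b ⊆ (Set.diagonal ℝ)ᶜ := fun hab z hz hzd =>
    absurd hzd (ne_of_lt (cover_subset_rightward hab hz))
  have hsub' : ∀ {a b : ℝ}, a ≤ b → Prod.swap ⁻¹' cover a b ⊆ (Set.diagonal ℝ)ᶜ :=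
    fun hab z hz hzd => absurd hzd (ne_of_gt (cover_subset_rightward hab hz))
  have hsm : IsFiniteMeasure (m • singularCoupling (m⁻¹ • μ') (m⁻¹ • ν')) :=
    Measure.smul_finite _ hmt
  -- Both measures have the same masses on covering routes: the factor `m` cancels the normalization
  -- `m⁻¹` inside the infimum.
  refine ext_of_cover hγd ?_ (fun a b hab => ?_) fun a b hab => ?_
  · rw [Measure.smul_apply, singularCoupling_diagonal, smul_zero]
  · rw [hγ', Measure.restrict_apply (measurableSet_cover a b), Set.inter_eq_left.2 (hsub hab),
      hcov a b hab, Measure.smul_apply, singularCoupling_cover _ _ hab, smul_eq_mul]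
    simp_rw [cdfDiff_smul, hcdf]
    rw [mul_iInf_ofReal hm0 hmt]
  · rw [hγ', Measure.restrict_apply (measurable_swap (measurableSet_cover a b)),
      Set.inter_eq_left.2 (hsub' hab), hcov' a b hab, Measure.smul_apply,
      singularCoupling_preimage_swap_cover _ _ hab, smul_eq_mul]
    simp_rw [cdfDiff_smul, cdfDiff_swap μ' ν', hcdf, ← cdfDiff_swap μ ν]
    rw [mul_iInf_ofReal hm0 hmt]

/-! ### Compactness of the set of plans and limits of optimal plans -/

section plans

variable {μ ν : Measure ℝ} [IsProbabilityMeasure μ] [IsProbabilityMeasure ν]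

lemma isClosed_Marg : IsClosed (Marg μ ν) := by
  have h1 : Continuous fun π : ProbabilityMeasure (ℝ × ℝ) =>
      π.map (measurable_fst (α := ℝ) (β := ℝ)).aemeasurable :=
    ProbabilityMeasure.continuous_map continuous_fst
  have h2 : Continuous fun π : ProbabilityMeasure (ℝ × ℝ) =>
      π.map (measurable_snd (α := ℝ) (β := ℝ)).aemeasurable :=
    ProbabilityMeasure.continuous_map continuous_snd
  obtain ⟨P, hP⟩ : ∃ P : ProbabilityMeasure ℝ, (P : Measure ℝ) = μ := ⟨⟨μ, inferInstance⟩, rfl⟩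
  obtain ⟨Q, hQ⟩ : ∃ Q : ProbabilityMeasure ℝ, (Q : Measure ℝ) = ν := ⟨⟨ν, inferInstance⟩, rfl⟩
  have e : Marg μ ν = {π | π.map (measurable_fst (α := ℝ) (β := ℝ)).aemeasurable = P} ∩
      {π | π.map (measurable_snd (α := ℝ) (β := ℝ)).aemeasurable = Q} := by
    ext π
    exact ⟨fun h => ⟨Subtype.ext (h.1.trans hP.symm), Subtype.ext (h.2.trans hQ.symm)⟩,
      fun h => ⟨(congrArg Subtype.val h.1).trans hP, (congrArg Subtype.val h.2).trans hQ⟩⟩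
  rw [e]
  exact (isClosed_eq h1 continuous_const).inter (isClosed_eq h2 continuous_const)

/-- Tightness of the two fixed marginals gives uniform tightness of the plans, and Prokhorov's
theorem applies. -/
lemma isCompact_Marg : IsCompact (Marg μ ν) := by
  rw [← isClosed_Marg.closure_eq]
  refine isCompact_closure_of_isTightMeasureSet ?_
  rw [isTightMeasureSet_iff_exists_isCompact_measure_compl_le]
  intro ε hε
  have hε2 : 0 < ε / 2 := ENNReal.half_pos hε.ne'
  obtain ⟨K, hK, hKμ⟩ := isTightMeasureSet_iff_exists_isCompact_measure_compl_le.1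
    (isTightMeasureSet_singleton (μ := μ)) _ hε2
  obtain ⟨L, hL, hLν⟩ := isTightMeasureSet_iff_exists_isCompact_measure_compl_le.1
    (isTightMeasureSet_singleton (μ := ν)) _ hε2
  refine ⟨K ×ˢ L, hK.prod hL, ?_⟩
  rintro _ ⟨π, hπ, rfl⟩
  have h1 : (π : Measure (ℝ × ℝ)) (Prod.fst ⁻¹' Kᶜ) = μ Kᶜ := by
    rw [← Measure.map_apply measurable_fst hK.measurableSet.compl, hπ.1]
  have h2 : (π : Measure (ℝ × ℝ)) (Prod.snd ⁻¹' Lᶜ) = ν Lᶜ := by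
    rw [← Measure.map_apply measurable_snd hL.measurableSet.compl, hπ.2]
  calc (π : Measure (ℝ × ℝ)) (K ×ˢ L)ᶜ
      ≤ (π : Measure (ℝ × ℝ)) (Prod.fst ⁻¹' Kᶜ ∪ Prod.snd ⁻¹' Lᶜ) := by
        refine measure_mono fun z hz => ?_
        by_contra hno
        simp only [Set.mem_union, Set.mem_preimage, Set.mem_compl_iff, not_or, not_not] at hno
        exact hz hno
    _ ≤ μ Kᶜ + ν Lᶜ := by
        rw [← h1, ← h2]
        exact measure_union_le _ _
    _ ≤ ε / 2 + ε / 2 := add_le_add (hKμ μ rfl) (hLν ν rfl)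
    _ = ε := ENNReal.add_halves ε

lemma Marg_nonempty : (Marg μ ν).Nonempty := by
  refine ⟨⟨μ.prod ν, inferInstance⟩, ?_, ?_⟩
  · rw [ProbabilityMeasure.coe_mk, Measure.map_fst_prod]
    simp
  · rw [ProbabilityMeasure.coe_mk, Measure.map_snd_prod]
    simp

end plans

/-! ### Semicontinuity of the costs, minimizers and their limits. -/

lemma lintegral_le_liminf {f : ℝ × ℝ → ℝ} (hf : Continuous f) (h0 : 0 ≤ f)
    {π : ProbabilityMeasure (ℝ × ℝ)} {πs : ℕ → ProbabilityMeasure (ℝ × ℝ)}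
    (h : Tendsto πs atTop (𝓝 π)) :
    ∫⁻ z, ENNReal.ofReal (f z) ∂(π : Measure (ℝ × ℝ)) ≤
      liminf (fun n => ∫⁻ z, ENNReal.ofReal (f z) ∂(πs n : Measure (ℝ × ℝ))) atTop :=
  lintegral_le_liminf_lintegral_of_forall_isOpen_measure_le_liminf_measure hf h0 fun _ hG =>
    ProbabilityMeasure.le_liminf_measure_open_of_tendsto h hG

lemma profileCost_le_liminf {g : ℝ → ℝ} (hg : Continuous fun r => g |r|) (hg0 : ∀ r, 0 ≤ g |r|)
    {π : ProbabilityMeasure (ℝ × ℝ)} {πs : ℕ → ProbabilityMeasure (ℝ × ℝ)}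
    (h : Tendsto πs atTop (𝓝 π)) :
    profileCost g π ≤ liminf (fun n => profileCost g (πs n)) atTop :=
  lintegral_le_liminf (f := fun z => g |z.2 - z.1|)
    (hg.comp (continuous_snd.sub continuous_fst)) (fun _ => hg0 _) h

lemma exists_minimizer {μ ν : Measure ℝ} [IsProbabilityMeasure μ] [IsProbabilityMeasure ν]
    {g : ℝ → ℝ} (hg : Continuous fun r => g |r|) (hg0 : ∀ r, 0 ≤ g |r|) :
    ∃ π ∈ Marg μ ν, ∀ γ ∈ Marg μ ν, profileCost g π ≤ profileCost g γ := by
  set I := sInf (profileCost g '' Marg μ ν) with hI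
  obtain ⟨u, -, hu, humem⟩ := exists_seq_tendsto_sInf
    (Marg_nonempty.image (profileCost g) : (profileCost g '' Marg μ ν).Nonempty)
    (OrderBot.bddBelow _)
  choose γ hγ hγu using humem
  obtain ⟨π, hπ, φ, hφ, hlim⟩ := (isCompact_Marg (μ := μ) (ν := ν)).isSeqCompact hγ
  refine ⟨π, hπ, fun ρ hρ => ?_⟩
  have h1 := profileCost_le_liminf hg hg0 hlim
  have h2 : Tendsto (fun n => profileCost g ((γ ∘ φ) n)) atTop (𝓝 I) := by
    have : (fun n => profileCost g ((γ ∘ φ) n)) = u ∘ φ := funext fun n => hγu (φ n)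
    rw [this]
    exact hu.comp hφ.tendsto_atTop
  rw [h2.liminf_eq] at h1
  exact h1.trans (sInf_le ⟨ρ, hρ, rfl⟩)

lemma profileCost_ne_top {μ ν : Measure ℝ} [IsProbabilityMeasure μ] [IsProbabilityMeasure ν]
    (hμ : Integrable (fun x : ℝ => x) μ) (hν : Integrable (fun x : ℝ => x) ν)
    {g : ℝ → ℝ} {C : ℝ} (hC : 0 ≤ C) (hg : ∀ r, 0 ≤ r → g r ≤ C * (1 + r))
    {π : ProbabilityMeasure (ℝ × ℝ)} (hπ : π ∈ Marg μ ν) : profileCost g π ≠ ∞ := by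
  have hle : ∀ z : ℝ × ℝ, g |z.2 - z.1| ≤ C * (1 + (‖z.1‖ + ‖z.2‖)) := by
    intro z
    refine (hg _ (abs_nonneg _)).trans ?_
    have : |z.2 - z.1| ≤ ‖z.1‖ + ‖z.2‖ := by
      rw [add_comm]
      exact abs_sub _ _
    gcongr
  have h1 : Integrable (fun z : ℝ × ℝ => z.1) (π : Measure (ℝ × ℝ)) := by
    have : Integrable (fun x : ℝ => x) ((π : Measure (ℝ × ℝ)).map Prod.fst) := by rwa [hπ.1]
    exact this.comp_measurable measurable_fst
  have h2 : Integrable (fun z : ℝ × ℝ => z.2) (π : Measure (ℝ × ℝ)) := by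
    have : Integrable (fun x : ℝ => x) ((π : Measure (ℝ × ℝ)).map Prod.snd) := by rwa [hπ.2]
    exact this.comp_measurable measurable_snd
  have h3 : Integrable (fun z : ℝ × ℝ => C * (1 + (‖z.1‖ + ‖z.2‖))) (π : Measure (ℝ × ℝ)) :=
    ((integrable_const 1).add (h1.norm.add h2.norm)).const_mul C
  refine ne_top_of_le_ne_top h3.lintegral_lt_top.ne ?_
  exact lintegral_mono fun z => ENNReal.ofReal_le_ofReal (hle z)

lemma tendsto_prod_self {π : ProbabilityMeasure (ℝ × ℝ)} {πs : ℕ → ProbabilityMeasure (ℝ × ℝ)}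
    (h : Tendsto πs atTop (𝓝 π)) :
    Tendsto (fun n => (πs n).prod (πs n)) atTop (𝓝 (π.prod π)) :=
  (ProbabilityMeasure.continuous_prod.tendsto (π, π)).comp (h.prodMk_nhds h)

/-- By the portmanteau theorem for `π ⊗ π`, an open condition on pairs of routes that is almost
surely excluded remains so in the limit. -/
lemma prod_eq_zero_of_tendsto {π : ProbabilityMeasure (ℝ × ℝ)}
    {πs : ℕ → ProbabilityMeasure (ℝ × ℝ)} (h : Tendsto πs atTop (𝓝 π))
    {O : Set ((ℝ × ℝ) × ℝ × ℝ)} (hO : IsOpen O)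
    (h0 : ∀ n, ((πs n : Measure (ℝ × ℝ)).prod (πs n : Measure (ℝ × ℝ))) O = 0) :
    ((π : Measure (ℝ × ℝ)).prod (π : Measure (ℝ × ℝ))) O = 0 := by
  have := ProbabilityMeasure.le_liminf_measure_open_of_tendsto (tendsto_prod_self h) hO
  simp only [ProbabilityMeasure.toMeasure_prod, h0] at this
  simpa using this

lemma profileCost_id (π : ProbabilityMeasure (ℝ × ℝ)) :
    profileCost (fun r => r) π = transportCost 1 π := by
  simp [profileCost, transportCost]

/-- Overlapping routes in opposite directions are not optimal for the distance. -/
lemma mem_improvable_of_overlap {z w : ℝ × ℝ} {t : ℝ} (hz : z ∈ cover t t)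
    (hw : w.swap ∈ cover t t) : (z, w) ∈ improvable fun r => r := by
  obtain ⟨h1, h2⟩ := mem_cover.1 hz
  obtain ⟨h3, h4⟩ := mem_cover.1 hw
  simp only [Prod.fst_swap, Prod.snd_swap] at h3 h4
  change |w.2 - z.1| + |z.2 - w.1| < |z.2 - z.1| + |w.2 - w.1|
  rw [abs_of_pos (by linarith : 0 < z.2 - z.1), abs_of_neg (by linarith : w.2 - w.1 < 0)]
  rcases abs_cases (w.2 - z.1) with ⟨e1, -⟩ | ⟨e1, -⟩ <;>
    rcases abs_cases (z.2 - w.1) with ⟨e2, -⟩ | ⟨e2, -⟩ <;> rw [e1, e2] <;> linarith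

lemma isOpen_lt_lt_lt {X : Type*} [TopologicalSpace X] {f₁ f₂ f₃ f₄ : X → ℝ}
    (h₁ : Continuous f₁) (h₂ : Continuous f₂) (h₃ : Continuous f₃) (h₄ : Continuous f₄) :
    IsOpen {p | f₁ p < f₂ p ∧ f₂ p < f₃ p ∧ f₃ p < f₄ p} :=
  (isOpen_lt h₁ h₂).inter ((isOpen_lt h₂ h₃).inter (isOpen_lt h₃ h₄))

/-- A limit of optimal plans for strictly concave costs that is optimal for the distance is the
excursion coupling. -/
theorem eq_excursionCoupling_of_tendsto {μ ν : Measure ℝ} [IsProbabilityMeasure μ]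
    [IsProbabilityMeasure ν] {g : ℕ → ℝ → ℝ} (hg : ∀ n, ConcaveProfile (g n))
    {π : ProbabilityMeasure (ℝ × ℝ)} {πs : ℕ → ProbabilityMeasure (ℝ × ℝ)}
    (hπs : ∀ n, πs n ∈ Marg μ ν) (hfin : ∀ n, profileCost (g n) (πs n) ≠ ∞)
    (hmin : ∀ n, ∀ γ ∈ Marg μ ν, profileCost (g n) (πs n) ≤ profileCost (g n) γ)
    (hlim : Tendsto πs atTop (𝓝 π)) (hopt : π ∈ OptMarg 1 μ ν) (hfin1 : transportCost 1 π ≠ ∞) :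
    (π : Measure (ℝ × ℝ)) = excursionCoupling μ ν := by
  have himp : ∀ n, ((πs n : Measure (ℝ × ℝ)).prod (πs n : Measure (ℝ × ℝ)))
      (improvable (g n)) = 0 := fun n =>
    prod_improvable_eq_zero (hg n).continuous_abs (fun r => (hg n).nonneg (abs_nonneg r))
      (hπs n) (hfin n) (hmin n)
  -- The sets `improvable (g n)` depend on `n`, but each contains the same open crossing regions, so
  -- these are null for the limit.
  have hOR : IsOpen {p : (ℝ × ℝ) × ℝ × ℝ | p.1.1 < p.2.1 ∧ p.2.1 < p.1.2 ∧ p.1.2 < p.2.2} :=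
    isOpen_lt_lt_lt (by fun_prop) (by fun_prop) (by fun_prop) (by fun_prop)
  have hOL : IsOpen {p : (ℝ × ℝ) × ℝ × ℝ | p.1.2 < p.2.2 ∧ p.2.2 < p.1.1 ∧ p.1.1 < p.2.1} :=
    isOpen_lt_lt_lt (by fun_prop) (by fun_prop) (by fun_prop) (by fun_prop)
  have hright : ((π : Measure (ℝ × ℝ)).prod (π : Measure (ℝ × ℝ)))
      {p | p.1.1 < p.2.1 ∧ p.2.1 < p.1.2 ∧ p.1.2 < p.2.2} = 0 := by
    exact prod_eq_zero_of_tendsto hlim hOR fun n =>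
      measure_mono_null (hg n).cross_right_subset (himp n)
  have hleft : ((π : Measure (ℝ × ℝ)).prod (π : Measure (ℝ × ℝ)))
      {p | p.1.2 < p.2.2 ∧ p.2.2 < p.1.1 ∧ p.1.1 < p.2.1} = 0 := by
    exact prod_eq_zero_of_tendsto hlim hOL fun n =>
      measure_mono_null (hg n).cross_left_subset (himp n)
  have hid : Continuous fun r : ℝ => (fun s : ℝ => s) |r| := continuous_abs
  have hover : ((π : Measure (ℝ × ℝ)).prod (π : Measure (ℝ × ℝ))) (improvable fun r => r) = 0 := by
    refine prod_improvable_eq_zero hid (fun r => abs_nonneg r) hopt.1 ?_ fun γ hγ => ?_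
    · rwa [profileCost_id]
    · rw [profileCost_id, profileCost_id]
      exact hopt.2 γ hγ
  have hdm : MeasurableSet (Set.diagonal ℝ) := isClosed_diagonal.measurableSet
  have hαapp : ∀ (ρ : Measure (ℝ × ℝ)) {B : Set ℝ}, MeasurableSet B →
      (ρ.restrict (Set.diagonal ℝ)).map Prod.fst B = ρ (Prod.fst ⁻¹' B ∩ Set.diagonal ℝ) :=
    fun ρ B hB => by
      rw [Measure.map_apply measurable_fst hB, Measure.restrict_apply (measurable_fst hB)]
  -- The exclusion of chains need not follow for the limit from openness, as the costs vary.
  -- Instead, every `πs n` carries the common mass on the diagonal, and masses of closed sets are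
  -- upper semicontinuous.
  have hclosed : ∀ C : Set ℝ, IsClosed C →
      (μ ⊓ ν) C ≤ ((π : Measure (ℝ × ℝ)).restrict (Set.diagonal ℝ)).map Prod.fst C := by
    intro C hC
    have h1 := ProbabilityMeasure.limsup_measure_closed_le_of_tendsto hlim
      ((hC.preimage continuous_fst).inter isClosed_diagonal :
        IsClosed (Prod.fst ⁻¹' C ∩ Set.diagonal ℝ))
    have h2 : ∀ n, (πs n : Measure (ℝ × ℝ)) (Prod.fst ⁻¹' C ∩ Set.diagonal ℝ) = (μ ⊓ ν) C := by
      intro n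
      rw [← hαapp _ hC.measurableSet, ← (hg n).inf_eq (hπs n) (hfin n) (hmin n)]
    simp only [h2, limsup_const] at h1
    rwa [hαapp _ hC.measurableSet]
  have hinf : μ ⊓ ν = ((π : Measure (ℝ × ℝ)).restrict (Set.diagonal ℝ)).map Prod.fst := by
    refine le_antisymm (Measure.le_iff.2 fun B hB => ?_)
      (map_fst_restrict_diagonal_le_inf hopt.1.1 hopt.1.2)
    have : IsFiniteMeasure (μ ⊓ ν) := isFiniteMeasure_of_le μ inf_le_left
    rw [hB.measure_eq_iSup_isClosed_of_ne_top (measure_ne_top (μ ⊓ ν) B)]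
    exact iSup₂_le fun C hCB => iSup_le fun hC => (hclosed C hC).trans (measure_mono hCB)
  refine eq_excursionCoupling hopt.1.1 hopt.1.2 Measure.isClosed_support.measurableSet
    Measure.measure_compl_support ?_ ?_ ?_ hinf
  · exact fun z hz w hw h => notMem_of_mem_support hOR hright hz hw h
  · exact fun z hz w hw h => notMem_of_mem_support hOL hleft hz hw h
  · exact fun z hz w hw t hzt hwt => notMem_of_mem_support (isOpen_improvable hid) hover hz hw
      (mem_improvable_of_overlap hzt hwt)

/-! ### Power costs -/

lemma strictConcaveOn_add_rpow {ε q : ℝ} (hε : 0 < ε) (hq0 : 0 < q) (hq1 : q < 1) :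
    StrictConcaveOn ℝ (Set.Ici 0) fun r : ℝ => r + ε * r ^ q := by
  refine ⟨convex_Ici 0, fun x hx y hy hxy a b ha hb hab => ?_⟩
  have := mul_lt_mul_of_pos_left
    ((Real.strictConcaveOn_rpow hq0 hq1).2 hx hy hxy ha hb hab) hε
  simp only [smul_eq_mul] at this ⊢
  linarith

lemma concaveProfile_rpow {p : ℝ} (hp0 : 0 < p) (hp1 : p < 1) :
    ConcaveProfile fun r => r ^ p where
  continuous_abs := continuous_abs.rpow_const fun _ => Or.inr hp0.le
  mono _ hr _ _ hrs := Real.rpow_le_rpow hr hrs hp0.le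
  concave := Real.strictConcaveOn_rpow hp0 hp1
  zero := Real.zero_rpow hp0.ne'

lemma concaveProfile_add_rpow {ε q : ℝ} (hε : 0 < ε) (hq0 : 0 < q) (hq1 : q < 1) :
    ConcaveProfile fun r => r + ε * r ^ q where
  continuous_abs := continuous_abs.add
    (continuous_const.mul (continuous_abs.rpow_const fun _ => Or.inr hq0.le))
  mono _ hr _ _ hrs := add_le_add hrs
    (mul_le_mul_of_nonneg_left (Real.rpow_le_rpow hr hrs hq0.le) hε.le)
  concave := strictConcaveOn_add_rpow hε hq0 hq1
  zero := by simp [Real.zero_rpow hq0.ne']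

lemma rpow_le_one_add {p r : ℝ} (hp0 : 0 < p) (hp1 : p ≤ 1) (hr : 0 ≤ r) : r ^ p ≤ 1 + r := by
  rcases le_total r 1 with h | h
  · exact (Real.rpow_le_one hr h hp0.le).trans (by linarith)
  · calc r ^ p ≤ r ^ (1 : ℝ) := Real.rpow_le_rpow_of_exponent_le h hp1
      _ ≤ 1 + r := by rw [Real.rpow_one]; linarith

/-- Split `s = s ^ (1 - p) * s ^ p`. The factor `R ^ (1 - p)` tends to `1` as `p → 1`, so truncated
distances are controlled by the costs with exponent `p`. -/
lemma min_le_mul_rpow {p r R : ℝ} (hp0 : 0 < p) (hp1 : p < 1) (hr : 0 ≤ r) (hR : 0 < R) :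
    min r R ≤ R ^ (1 - p) * r ^ p := by
  set s := min r R
  have hs : 0 ≤ s := le_min hr hR.le
  rcases hs.eq_or_lt with h | h
  · rw [← h]
    positivity
  calc s = s ^ (1 - p) * s ^ p := by rw [← Real.rpow_add h]; simp
    _ ≤ R ^ (1 - p) * r ^ p :=
      mul_le_mul (Real.rpow_le_rpow hs (min_le_right _ _) (by linarith))
        (Real.rpow_le_rpow hs (min_le_left _ _) hp0.le) (by positivity) (by positivity)

lemma profileCost_add_rpow {ε q : ℝ} (hε : 0 < ε) (π : ProbabilityMeasure (ℝ × ℝ)) :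
    profileCost (fun r => r + ε * r ^ q) π =
      transportCost 1 π + ENNReal.ofReal ε * transportCost q π := by
  have hm : Measurable fun z : ℝ × ℝ => ENNReal.ofReal (|z.2 - z.1| ^ (1 : ℝ)) := by
    simp only [Real.rpow_one]
    exact (ENNReal.continuous_ofReal.comp (continuous_snd.sub continuous_fst).abs).measurable
  rw [profileCost, transportCost, transportCost, ← lintegral_const_mul' _ _ ENNReal.ofReal_ne_top,
    ← lintegral_add_left hm]
  refine lintegral_congr fun z => ?_
  rw [Real.rpow_one, ENNReal.ofReal_add (abs_nonneg _) (by positivity), ENNReal.ofReal_mul hε.le]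

/-! ### Limits of optimal plans as the costs tend to the distance. -/

section

variable {μ ν : Measure ℝ} [IsProbabilityMeasure μ] [IsProbabilityMeasure ν]
  (hμ : Integrable (fun x : ℝ => x) μ) (hν : Integrable (fun x : ℝ => x) ν)
include hμ hν

lemma transportCost_ne_top {p : ℝ} (hp0 : 0 < p) (hp1 : p ≤ 1) {π : ProbabilityMeasure (ℝ × ℝ)}
    (hπ : π ∈ Marg μ ν) : transportCost p π ≠ ∞ :=
  profileCost_ne_top (g := fun r => r ^ p) hμ hν zero_le_one
    (fun r hr => by rw [one_mul]; exact rpow_le_one_add hp0 hp1 hr) hπ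

lemma tendsto_transportCost {p : ℕ → ℝ} (hp : ∀ n, 0 < p n ∧ p n < 1)
    (hlim : Tendsto p atTop (𝓝 1)) {γ : ProbabilityMeasure (ℝ × ℝ)} (hγ : γ ∈ Marg μ ν) :
    Tendsto (fun n => transportCost (p n) γ) atTop (𝓝 (transportCost 1 γ)) := by
  have hb : profileCost (fun r => 1 + r) γ ≠ ∞ :=
    profileCost_ne_top hμ hν zero_le_one (fun r _ => by rw [one_mul]) hγ
  refine tendsto_lintegral_of_dominated_convergence
    (fun z => ENNReal.ofReal (1 + |z.2 - z.1|)) (fun n => ?_) (fun n => ?_) hb ?_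
  · have : Continuous fun z : ℝ × ℝ => |z.2 - z.1| ^ p n :=
      (continuous_snd.sub continuous_fst).abs.rpow_const fun _ => Or.inr (hp n).1.le
    exact (ENNReal.continuous_ofReal.comp this).measurable
  · exact Eventually.of_forall fun z => ENNReal.ofReal_le_ofReal
      (rpow_le_one_add (hp n).1 (hp n).2.le (abs_nonneg _))
  · refine Eventually.of_forall fun z => (ENNReal.continuous_ofReal.tendsto _).comp ?_
    exact tendsto_const_nhds.rpow hlim (Or.inr one_pos)

/-- Limits of optimal plans for the exponents `p n → 1` are optimal for the distance. -/
lemma mem_OptMarg_one_of_tendsto {p : ℕ → ℝ} {πs : ℕ → ProbabilityMeasure (ℝ × ℝ)}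
    (hp : ∀ n, 0 < p n ∧ p n < 1) (hlim : Tendsto p atTop (𝓝 1))
    (hπs : ∀ n, πs n ∈ OptMarg (p n) μ ν) {π : ProbabilityMeasure (ℝ × ℝ)}
    (hπ : Tendsto πs atTop (𝓝 π)) : π ∈ OptMarg 1 μ ν := by
  refine ⟨isClosed_Marg.mem_of_tendsto hπ (Eventually.of_forall fun n => (hπs n).1),
    fun γ hγ => ?_⟩
  have hc : ∀ R : ℝ, Continuous fun z : ℝ × ℝ => min |z.2 - z.1| R := fun R =>
    (continuous_snd.sub continuous_fst).abs.min continuous_const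
  -- The truncation makes the integrand independent of `n`, so lower semicontinuity along `πs`
  -- applies. The truncation level is sent to infinity afterwards.
  have key : ∀ R : ℝ, 0 < R →
      ∫⁻ z, ENNReal.ofReal (min |z.2 - z.1| R) ∂(π : Measure (ℝ × ℝ)) ≤ transportCost 1 γ := by
    intro R hR
    refine (lintegral_le_liminf (hc R) (fun z => le_min (abs_nonneg _) hR.le) hπ).trans ?_
    have h1 : ∀ n, ∫⁻ z, ENNReal.ofReal (min |z.2 - z.1| R) ∂(πs n : Measure (ℝ × ℝ)) ≤
        ENNReal.ofReal (R ^ (1 - p n)) * transportCost (p n) γ := by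
      intro n
      calc ∫⁻ z, ENNReal.ofReal (min |z.2 - z.1| R) ∂(πs n : Measure (ℝ × ℝ))
          ≤ ∫⁻ z, ENNReal.ofReal (R ^ (1 - p n)) * ENNReal.ofReal (|z.2 - z.1| ^ p n)
              ∂(πs n : Measure (ℝ × ℝ)) := by
            refine lintegral_mono fun z => ?_
            rw [← ENNReal.ofReal_mul (by positivity)]
            exact ENNReal.ofReal_le_ofReal
              (min_le_mul_rpow (hp n).1 (hp n).2 (abs_nonneg _) hR)
        _ = ENNReal.ofReal (R ^ (1 - p n)) * transportCost (p n) (πs n) :=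
            lintegral_const_mul' _ _ ENNReal.ofReal_ne_top
        _ ≤ ENNReal.ofReal (R ^ (1 - p n)) * transportCost (p n) γ := by
            gcongr
            exact (hπs n).2 γ hγ
    have h2 : Tendsto (fun n => ENNReal.ofReal (R ^ (1 - p n)) * transportCost (p n) γ) atTop
        (𝓝 (1 * transportCost 1 γ)) := by
      refine ENNReal.Tendsto.mul ?_ (Or.inl one_ne_zero) (tendsto_transportCost hμ hν hp hlim hγ)
        (Or.inr ENNReal.one_ne_top)
      have h3 : Tendsto (fun n => R ^ (1 - p n)) atTop (𝓝 (R ^ (1 - 1 : ℝ))) :=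
        tendsto_const_nhds.rpow (tendsto_const_nhds.sub hlim) (Or.inl hR.ne')
      rw [sub_self, Real.rpow_zero] at h3
      rw [← ENNReal.ofReal_one]
      exact (ENNReal.continuous_ofReal.tendsto _).comp h3
    rw [one_mul] at h2
    exact (liminf_le_liminf (Eventually.of_forall h1)).trans_eq h2.liminf_eq
  have h4 : ∀ z : ℝ × ℝ, ENNReal.ofReal (|z.2 - z.1| ^ (1 : ℝ)) =
      liminf (fun n : ℕ => ENNReal.ofReal (min |z.2 - z.1| ((n : ℝ) + 1))) atTop := by
    intro z
    refine (Tendsto.liminf_eq ?_).symm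
    rw [Real.rpow_one]
    refine tendsto_const_nhds.congr' ?_
    obtain ⟨N, hN⟩ := exists_nat_ge |z.2 - z.1|
    filter_upwards [eventually_ge_atTop N] with n hn
    have : (N : ℝ) ≤ n := by exact_mod_cast hn
    rw [min_eq_left (by linarith)]
  calc transportCost 1 π
      = ∫⁻ z, liminf (fun n : ℕ => ENNReal.ofReal (min |z.2 - z.1| ((n : ℝ) + 1))) atTop
          ∂(π : Measure (ℝ × ℝ)) := lintegral_congr h4
    _ ≤ liminf (fun n : ℕ => ∫⁻ z, ENNReal.ofReal (min |z.2 - z.1| ((n : ℝ) + 1))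
          ∂(π : Measure (ℝ × ℝ))) atTop :=
        lintegral_liminf_le fun n => (ENNReal.continuous_ofReal.comp (hc _)).measurable
    _ ≤ transportCost 1 γ :=
        liminf_le_of_frequently_le' (Frequently.of_forall fun n => key _ (by positivity))

/-- The excursion coupling minimizes `T_q` among the plans that are optimal for the distance. -/
theorem exists_eq_excursionCoupling {q : ℝ} (hq0 : 0 < q) (hq1 : q < 1) :
    ∃ π : ProbabilityMeasure (ℝ × ℝ), (π : Measure (ℝ × ℝ)) = excursionCoupling μ ν ∧
      π ∈ OptMarg 1 μ ν ∧ ∀ γ ∈ OptMarg 1 μ ν, transportCost q π ≤ transportCost q γ := by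
  -- The perturbation `ε n * r ^ q` makes the distance strictly concave and acts as a tie-break
  -- among the distance-optimal plans.
  set ε : ℕ → ℝ := fun n => 1 / ((n : ℝ) + 1) with hε
  have hε0 : ∀ n, 0 < ε n := fun n => by positivity
  have hε1 : ∀ n, ε n ≤ 1 := fun n => by
    rw [hε, div_le_one (by positivity)]
    linarith [(Nat.cast_nonneg n : (0 : ℝ) ≤ n)]
  have hεlim : Tendsto ε atTop (𝓝 0) := tendsto_one_div_add_atTop_nhds_zero_nat
  have hg : ∀ n, ConcaveProfile fun r => r + ε n * r ^ q := fun n =>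
    concaveProfile_add_rpow (hε0 n) hq0 hq1
  choose γ hγ hγmin using fun n => exists_minimizer (μ := μ) (ν := ν)
    (g := fun r => r + ε n * r ^ q) (hg n).continuous_abs
    fun r => (hg n).nonneg (abs_nonneg r)
  have hfin : ∀ n, ∀ ρ ∈ Marg μ ν, profileCost (fun r => r + ε n * r ^ q) ρ ≠ ∞ := fun n ρ hρ => by
    -- The constant `2` works because `ε n ≤ 1` and `r ^ q ≤ 1 + r`.
    refine profileCost_ne_top hμ hν zero_le_two (fun r hr => ?_) hρ
    have h1 := rpow_le_one_add hq0 hq1.le hr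
    have h2 := mul_le_mul (hε1 n) h1 (by positivity) zero_le_one
    linarith
  obtain ⟨π, hπ, φ, hφ, hlim⟩ := (isCompact_Marg (μ := μ) (ν := ν)).isSeqCompact hγ
  have hεφ : Tendsto (fun n => ENNReal.ofReal (ε (φ n))) atTop (𝓝 0) := by
    rw [← ENNReal.ofReal_zero]
    exact (ENNReal.continuous_ofReal.tendsto _).comp (hεlim.comp hφ.tendsto_atTop)
  have hcompare : ∀ n, ∀ ρ ∈ Marg μ ν,
      transportCost 1 (γ n) + ENNReal.ofReal (ε n) * transportCost q (γ n) ≤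
        transportCost 1 ρ + ENNReal.ofReal (ε n) * transportCost q ρ := fun n ρ hρ => by
    rw [← profileCost_add_rpow (hε0 n), ← profileCost_add_rpow (hε0 n)]
    exact hγmin n ρ hρ
  have hopt : π ∈ OptMarg 1 μ ν := by
    refine ⟨hπ, fun ρ hρ => ?_⟩
    have h1 := profileCost_le_liminf (g := fun r => r) continuous_abs (fun r => abs_nonneg r) hlim
    simp only [profileCost_id] at h1
    have h2 : ∀ n, transportCost 1 ((γ ∘ φ) n) ≤
        transportCost 1 ρ + ENNReal.ofReal (ε (φ n)) * transportCost q ρ := fun n =>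
      le_self_add.trans (hcompare (φ n) ρ hρ)
    have h3 : Tendsto (fun n => transportCost 1 ρ + ENNReal.ofReal (ε (φ n)) * transportCost q ρ)
        atTop (𝓝 (transportCost 1 ρ + 0 * transportCost q ρ)) :=
      tendsto_const_nhds.add (ENNReal.Tendsto.mul_const hεφ
        (Or.inr (transportCost_ne_top hμ hν hq0 hq1.le hρ)))
    rw [zero_mul, add_zero] at h3
    exact h1.trans ((liminf_le_liminf (Eventually.of_forall h2)).trans_eq h3.liminf_eq)
  refine ⟨π, ?_, hopt, fun ρ hρ => ?_⟩
  · exact eq_excursionCoupling_of_tendsto (fun n => hg (φ n)) (fun n => hγ (φ n))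
      (fun n => hfin (φ n) _ (hγ (φ n))) (fun n => hγmin (φ n)) hlim hopt
      (transportCost_ne_top hμ hν one_pos le_rfl hπ)
  · have h1 := profileCost_le_liminf (g := fun r => r ^ q)
      (concaveProfile_rpow hq0 hq1).continuous_abs
      (fun r => (concaveProfile_rpow hq0 hq1).nonneg (abs_nonneg r)) hlim
    refine h1.trans (liminf_le_of_frequently_le' (Frequently.of_forall fun n => ?_))
    -- As `ρ` is optimal for the distance, its first-order term is at most that of the minimizer.
    -- This finite term cancels, and so does the positive factor `ε (φ n)`.
    have h2 := (hcompare (φ n) ρ hρ.1).trans (add_le_add_left (hρ.2 _ (hγ (φ n))) _)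
    have h3 := (ENNReal.add_le_add_iff_left
      (transportCost_ne_top hμ hν one_pos le_rfl (hγ (φ n)))).1 h2
    exact (ENNReal.mul_le_mul_iff_right (ENNReal.ofReal_pos.2 (hε0 _)).ne'
      ENNReal.ofReal_ne_top).1 h3

end

end Excursion

/-! ### The two limit statements. -/

theorem mainTheorem3 (μ ν : Measure ℝ) [IsProbabilityMeasure μ] [IsProbabilityMeasure ν]
    (hμ : Integrable (fun x : ℝ => x) μ) (hν : Integrable (fun x : ℝ => x) ν) :
    ∃ π : ProbabilityMeasure (ℝ × ℝ),
      (π : Measure (ℝ × ℝ)) = excursionCoupling μ ν ∧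
      π ∈ Marg μ ν ∧
      (∀ (p : ℕ → ℝ) (πs : ℕ → ProbabilityMeasure (ℝ × ℝ)),
        (∀ n, 0 < p n ∧ p n < 1) → Tendsto p atTop (𝓝 1) →
        (∀ n, πs n ∈ OptMarg (p n) μ ν) → Tendsto πs atTop (𝓝 π)) ∧
      (∀ q : ℝ, 0 < q → q < 1 →
        π ∈ OptMarg 1 μ ν ∧ ∀ γ ∈ OptMarg 1 μ ν, transportCost q π ≤ transportCost q γ) := by
  -- The exponent `1 / 2` is an arbitrary choice that provides `π`. For any other exponent the plan
  -- obtained has the same underlying measure.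
  obtain ⟨π, hπ, hopt, -⟩ :=
    Excursion.exists_eq_excursionCoupling hμ hν one_half_pos one_half_lt_one
  refine ⟨π, hπ, hopt.1, fun p πs hp hp1 hπs => ?_, fun q hq0 hq1 => ?_⟩
  -- By compactness every subsequence has a convergent subsequence, and each such limit is the
  -- excursion coupling.
  · refine tendsto_of_subseq_tendsto fun ns hns => ?_
    obtain ⟨γ, -, φ, hφ, hlim⟩ := (Excursion.isCompact_Marg (μ := μ) (ν := ν)).isSeqCompact
      fun n => (hπs (ns n)).1
    have hp1' : Tendsto (fun n => p (ns (φ n))) atTop (𝓝 1) :=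
      hp1.comp (hns.comp hφ.tendsto_atTop)
    have hγ := Excursion.mem_OptMarg_one_of_tendsto hμ hν (fun n => hp (ns (φ n))) hp1'
      (fun n => hπs (ns (φ n))) hlim
    have e : γ = π := Subtype.ext ((Excursion.eq_excursionCoupling_of_tendsto
      (fun n => Excursion.concaveProfile_rpow (hp (ns (φ n))).1 (hp (ns (φ n))).2)
      (fun n => (hπs (ns (φ n))).1)
      (fun n => Excursion.transportCost_ne_top hμ hν (hp _).1 (hp _).2.le (hπs (ns (φ n))).1)
      (fun n => (hπs (ns (φ n))).2) hlim hγ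
      (Excursion.transportCost_ne_top hμ hν one_pos le_rfl hγ.1)).trans hπ.symm)
    exact ⟨φ, e ▸ hlim⟩
  · obtain ⟨γ, hγ, h⟩ := Excursion.exists_eq_excursionCoupling hμ hν hq0 hq1
    obtain rfl : γ = π := Subtype.ext (hγ.trans hπ.symm)
    exact h
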